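/- Let $T=\sum_{j=0}^{k}Q_j(w)\frac{d^j}{dw^j}$ be a differential operator of order $k\ge 1$ with polynomial coefficients $Q_j\in\mathbb{C}[w]$, $Q_k\not\equiv 0$. Suppose that $T$ is non-degenerate, i.e. $\max_{0\le j\le k}(\deg Q_j-j)=\deg Q_k-k$ (with $\deg 0=-\infty$), that $d:=\deg Q_k\ge 1$, and that all zeros of $Q_k$ are simple. For $n\ge k$ let $P_n(z,w)=T[(w-z)^n]/(w-z)^{n-k}$, a polynomial in $z$ and $w$ ($T$ acts on the variable $w$). Let $\Gamma_n\subset\hat{\mathbb{C}}\times\hat{\mathbb{C}}$ be the closure of the curve $\{(z,w)\in\mathbb{C}^2:P_n(z,w)=0\}$, and let $T_n$ be the multivalued map $T_n(z)=\{w\in\hat{\mathbb{C}}:(z,w)\in\Gamma_n\}$ of $\hat{\mathbb{C}}$. The number $\deg_w P_n$ is its degree. For a finite Borel measure $\mu$ on $\hat{\mathbb{C}}$ the measure $(T_n)_*\mu$ is given by $\int\varphi\,d(T_n)_*\mu=\int\sum_{x\in T_n(a)}\varphi(x)\,d\mu(a)$ for continuous $\varphi$, with the points of $T_n(a)$ counted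 with multiplicities; $(T_n^m)_*$ is the $m$-fold iterate. A set $K\subset\hat{\mathbb{C}}$ is forward invariant if $T_n(K)\subset K$. A closed non-empty set $S\subset\mathbb{C}$ is Hutchinson invariant in degree $n$ if for every $z\in S$ all zeros $w$ of $T[(w-z)^n]$ lie in $S$; the smallest such set (contained in all others), if it exists, is denoted by $M_{H,n}$. A point $z\in\mathbb{C}$ is an attracting periodic point of $T_n$ if for some $l\ge 1$ there is a local holomorphic branch $g$ of $T_n^l$ at $z$ with $g(z)=z$ and $|g'(z)|<1$. Then for every $\epsilon>0$ there is $N\ge k$ such that for all $n\ge N$ the following hold. 1. $T_n$ has degree $d$, and there is a probability measure $\mu_{T_n}$ on $\hat{\mathbb{C}}$ with $(T_n)_*\mu_{T_n}=d\,\mu_{T_n}$ such that for every $a\in\mathbb{C}$ $$\frac{1}{d^m}(T_n^m)_*(\delta_a)\longrightarrow\mu_{T_n}\quad\text{weak-}*\text{ as } m\to\infty .$$ Its support is contained in the $\epsilon$-neighbourhood of the zeros of $Q_k$, and is the smallest closed set that is forward invariant under $T_n$ and contains a point of $\mathbb{C}$. Moreover $M_{H,n}$ exists and $M_{H,n}=\operatorname{supp}\mu_{T_n}$.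 2. Each point of $M_{H,n}$ is the limit of a sequence of attracting periodic points of $T_n$ and is contained in the $\epsilon$-neighbourhood of the zeros of $Q_k$. 3. If $k\ge 2$, at least one $Q_j$ with $j\ne k$ is not identically zero, $d\ge 2$, and $Q_0,\dots,Q_k$ have no common zero (that is, $\Gamma_n$ contains no horizontal line $\hat{\mathbb{C}}\times\{c\}$), then $M_{H,n}$ is a Cantor set, i.e. it is homeomorphic to the ternary Cantor set. -/

import Mathlib

open Polynomial Topology Filter MeasureTheory

open scoped Polynomial.Bivariate

noncomputable section

namespace HolCorr

/-! The Riemann sphere is the one-point compactification `OnePoint ℂ`, with its Borel σ-algebra. -/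

instance instMeasurableSpaceSphere : MeasurableSpace (OnePoint ℂ) := borel _

instance instBorelSpaceSphere : BorelSpace (OnePoint ℂ) := ⟨rfl⟩

/-! ### Holomorphic correspondences on the Riemann sphere

A polynomial `P(z, w)` is an element of `ℂ[X][Y]`: the inner variable is `z`, the outer one `w`. -/

/-- The closure in the product of two spheres of the affine plane curve `P(z, w) = 0`. -/
def graph (P : ℂ[X][Y]) : Set (OnePoint ℂ × OnePoint ℂ) :=
  closure {p | ∃ z w : ℂ, p = ((z : OnePoint ℂ), (w : OnePoint ℂ)) ∧ P.evalEval z w = 0}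

/-- The set `F(z)` of images of `z` under the correspondence `F : z → w` defined by `P(z, w) = 0`. -/
def image (P : ℂ[X][Y]) (z : OnePoint ℂ) : Set (OnePoint ℂ) := {w | (z, w) ∈ graph P}

/-- The set `F^l(z)` of images of `z` under the `l`-th iterate of the correspondence. -/
def iterImage (P : ℂ[X][Y]) : ℕ → OnePoint ℂ → Set (OnePoint ℂ)
  | 0, z => {z}
  | l + 1, z => {w | ∃ v ∈ iterImage P l z, w ∈ image P v}

/-- `F(K) ⊆ K`. -/
def ForwardInvariant (P : ℂ[X][Y]) (K : Set (OnePoint ℂ)) : Prop :=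
  ∀ z ∈ K, image P z ⊆ K

/-- The polynomial in `w` which cuts out the part in `ℂ` of the fibre over `a`: it is `P(a, w)` for
`a ∈ ℂ`, and the coefficient of the highest power of `z` in `P(z, w)` for `a = ∞`. -/
def slice (P : ℂ[X][Y]) : OnePoint ℂ → ℂ[X]
  | OnePoint.infty => (Bivariate.swap P).leadingCoeff
  | OnePoint.some a => P.map (evalRingHom a)

/-- The points of `F(a)` counted with multiplicities: the intersection of the curve with
`{a} × OnePoint ℂ`, consisting of `deg_w P` points (when `{a} × OnePoint ℂ` is not contained in
the curve). Horizontal components `OnePoint ℂ × {c}` contribute the point `c` to every fibre. -/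
def fibre (P : ℂ[X][Y]) (a : OnePoint ℂ) : Multiset (OnePoint ℂ) :=
  (slice P a).roots.map (fun w : ℂ => (w : OnePoint ℂ)) +
    Multiset.replicate (P.natDegree - (slice P a).natDegree) OnePoint.infty

/-- The points of `F^m(a)` counted with multiplicities. -/
def iterFibre (P : ℂ[X][Y]) : ℕ → OnePoint ℂ → Multiset (OnePoint ℂ)
  | 0, a => {a}
  | m + 1, a => (iterFibre P m a).bind (fibre P)

/-- The measure `(F^m)_* δ_a`, the sum of the Dirac masses at the points of `F^m(a)`. -/
def pushDirac (P : ℂ[X][Y]) (m : ℕ) (a : OnePoint ℂ) : Measure (OnePoint ℂ) :=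
  ((iterFibre P m a).map Measure.dirac).sum

/-- `F_* μ = ν` for finite measures, by duality with continuous functions:
`∫ φ d(F_* μ) = ∫ (∑_{x ∈ F(a)} φ x) dμ(a)`, points counted with multiplicities. -/
def IsPushforward (P : ℂ[X][Y]) (μ ν : Measure (OnePoint ℂ)) : Prop :=
  ∀ φ : C(OnePoint ℂ, ℝ),
    Integrable (fun a => ((fibre P a).map φ).sum) μ ∧
      ∫ x, φ x ∂ν = ∫ a, ((fibre P a).map φ).sum ∂μ

/-- `z ∈ ℂ` is an attracting periodic point: for some `l ≥ 1` there is a local holomorphic branch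
`g` of `F^l` at `z` with `g(z) = z` and `|g'(z)| < 1`. -/
def IsAttractingPeriodic (P : ℂ[X][Y]) (z : ℂ) : Prop :=
  ∃ l : ℕ, 1 ≤ l ∧ ∃ g : ℂ → ℂ, AnalyticAt ℂ g z ∧
    (∀ᶠ x : ℂ in 𝓝 z, (g x : OnePoint ℂ) ∈ iterImage P l (x : OnePoint ℂ)) ∧
    g z = z ∧ ‖deriv g z‖ < 1

/-! ### Differential operators -/

/-- The operator `∑_{j ≤ k} Q_j(w) d^j/dw^j`. -/
def diffOp {R : Type*} [CommRing R] (k : ℕ) (Q : ℕ → Polynomial R) (f : Polynomial R) :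
    Polynomial R :=
  ∑ j ∈ Finset.range (k + 1), Q j * derivative^[j] f

/-- The operator `∑_{j ≤ k} Q_j(w) d^j/dw^j` has order `k` and is non-degenerate:
`max_{j ≤ k} (deg Q_j - j) = deg Q_k - k`, where `deg 0 = -∞`. -/
def NonDegenerate (k : ℕ) (Q : ℕ → ℂ[X]) : Prop :=
  Q k ≠ 0 ∧ ∀ j ≤ k, Q j ≠ 0 → ((Q j).natDegree : ℤ) - j ≤ ((Q k).natDegree : ℤ) - k

/-- The polynomial `T[(w - z)^n] / (w - z)^(n - k)` in `z` and `w` (for `n ≥ k`), where `T` acts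
on the variable `w`. -/
def corrPoly (k : ℕ) (Q : ℕ → ℂ[X]) (n : ℕ) : ℂ[X][Y] :=
  diffOp k (fun j => (Q j).map C) ((Y - C X) ^ n) /ₘ (Y - C X) ^ (n - k)

/-- The division in `corrPoly` is exact. -/
theorem diffOp_pow_eq_mul {R : Type*} [CommRing R] (k : ℕ) (Q : ℕ → Polynomial R) (a : R) (n : ℕ)
    (hn : k ≤ n) :
    diffOp k Q ((X - C a) ^ n) = (X - C a) ^ (n - k) *
      ∑ j ∈ Finset.range (k + 1), (n.descFactorial j) • (Q j * (X - C a) ^ (k - j)) := by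
  unfold diffOp
  rw [Finset.mul_sum]
  refine Finset.sum_congr rfl fun j hj => ?_
  have hj' : j ≤ k := by simpa [Nat.lt_succ_iff] using hj
  rw [iterate_derivative_X_sub_pow, show n - j = (n - k) + (k - j) by omega, pow_add]
  simp only [nsmul_eq_mul]
  ring

theorem corrPoly_eq (k : ℕ) (Q : ℕ → ℂ[X]) (n : ℕ) (hn : k ≤ n) :
    corrPoly k Q n = ∑ j ∈ Finset.range (k + 1),
      (n.descFactorial j) • ((Q j).map C * (Y - C X) ^ (k - j)) := by
  unfold corrPoly
  rw [diffOp_pow_eq_mul k _ (X : ℂ[X]) n hn]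
  exact mul_divByMonic_cancel_left _ ((monic_X_sub_C _).pow _)

/-- A closed non-empty `S ⊆ ℂ` is Hutchinson invariant in degree `n` for `T = ∑ Q_j d^j/dw^j` if for
every `z ∈ S` all zeros of `T[(w - z)^n]` lie in `S`. -/
def HutchinsonInvariant (k : ℕ) (Q : ℕ → ℂ[X]) (n : ℕ) (S : Set ℂ) : Prop :=
  IsClosed S ∧ S.Nonempty ∧
    ∀ z ∈ S, ∀ w : ℂ, (diffOp k Q ((X - C z) ^ n)).eval w = 0 → w ∈ S

/-- `S` is a Cantor set: it is homeomorphic to the ternary Cantor set. -/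
def IsCantorSet (S : Set ℂ) : Prop := Nonempty (S ≃ₜ cantorSet)

end HolCorr

end

/-! Divided by the falling factorial n(n-1)⋯(n-k+1), `P_n(z, w)` becomes Q_k(w) + ∑_{j<k} c_j Q_j(w)
(w-z)^(k-j) with weights c_j = O(1/n). By non-degeneracy every summand has total degree at most d,
so the perturbation never outgrows Q_k: the degree in w stays d, and the zeros over z satisfy |w| <
max(|z|/2, R) for a fixed R. Over the disc |z| ≤ R the d simple zeros of Q_k persist as d
holomorphic branches, one near each zero, with a Lipschitz constant q that is as small as desired
once n is large (`exists_isContracting`, `IsContracting.exists_branches`,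
`IsContracting.norm_sub_le`). So T_n is an iterated function system of d contractions on the disc,
and all images of a point of ℂ enter the disc after finitely many steps.

The averages of a continuous function over the d^m images of a point converge to a constant
independent of the point, which defines the measure by Riesz representation
(`exists_measure_tendsto_transfer_pow`). Its support is the attractor, the least closed invariant
set. It is also M_{H,n}, because the only zero of T[(w-z)^n] that T_n can miss is z itself. A point
of the attractor lies in arbitrarily small images of the disc under compositions of branches, and
each composition has an attracting fixed point.

For the Cantor property, dq < 1 makes the attractor totally disconnected. Without a common zero of
the Q_j the branches are finite-to-one, so an infinite attractor is perfect, and Brouwer's theorem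
applies. Infinitude is the delicate point (`IsContracting.infinite_of_invariant`): by double
counting, a finite invariant set would contain exactly d preimages of each of its points, and
Vieta's formula for these preimages is contradictory. -/

noncomputable section

/-! ### The invariant measure of a finite system of contractions. -/

namespace IFS

/-- The composition `f i₁ ∘ ⋯ ∘ f iₗ` along a word `[i₁, …, iₗ]`. -/
def wordMap {ι α : Type*} (f : ι → α → α) : List ι → α → α
  | [], x => x
  | i :: l, x => f i (wordMap f l x)

section Transfer

variable {X ι : Type*} [MetricSpace X] [Fintype ι]

/-- The averaging operator `φ ↦ (1 / |ι|) ∑ i, φ ∘ f i` of an iterated function system. -/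
def transfer (f : ι → C(X, X)) : C(X, ℝ) →ₗ[ℝ] C(X, ℝ) where
  toFun φ := (Fintype.card ι : ℝ)⁻¹ • ∑ i, φ.comp (f i)
  map_add' φ ψ := by
    ext x
    simp [Finset.sum_add_distrib]
  map_smul' c φ := by
    ext x
    simp [← Finset.mul_sum, mul_left_comm]

theorem transfer_apply (f : ι → C(X, X)) (φ : C(X, ℝ)) (x : X) :
    transfer f φ x = (Fintype.card ι : ℝ)⁻¹ * ∑ i, φ (f i x) := by
  simp [transfer]

theorem transfer_pow_succ_apply (f : ι → C(X, X)) (φ : C(X, ℝ)) (m : ℕ) :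
    (transfer f ^ (m + 1)) φ = (transfer f ^ m) (transfer f φ) := by
  rw [pow_succ, Module.End.mul_apply]

theorem transfer_pow_succ_apply' (f : ι → C(X, X)) (φ : C(X, ℝ)) (m : ℕ) :
    (transfer f ^ (m + 1)) φ = transfer f ((transfer f ^ m) φ) := by
  rw [pow_succ', Module.End.mul_apply]

/-- Comparison is relative to a forward invariant K: K = univ gives bounds by constants, a closed K
locates the support of the invariant measure. -/
theorem transfer_mono (f : ι → C(X, X)) {φ ψ : C(X, ℝ)} {K : Set X}
    (hK : ∀ i, Set.MapsTo (f i) K K) (h : ∀ x ∈ K, φ x ≤ ψ x) :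
    ∀ x ∈ K, transfer f φ x ≤ transfer f ψ x := by
  intro x hx
  simp only [transfer_apply]
  gcongr with i
  exact h _ (hK i hx)

theorem transfer_pow_mono (f : ι → C(X, X)) {φ ψ : C(X, ℝ)} {K : Set X}
    (hK : ∀ i, Set.MapsTo (f i) K K) (h : ∀ x ∈ K, φ x ≤ ψ x) (m : ℕ) :
    ∀ x ∈ K, (transfer f ^ m) φ x ≤ (transfer f ^ m) ψ x := by
  induction m with
  | zero => simpa using h
  | succ m ih =>
    rw [transfer_pow_succ_apply', transfer_pow_succ_apply']
    exact transfer_mono f hK ih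

variable [Nonempty ι]

theorem transfer_const (f : ι → C(X, X)) (c : ℝ) :
    transfer f (ContinuousMap.const X c) = ContinuousMap.const X c := by
  ext x
  simp [transfer_apply]

theorem transfer_pow_const (f : ι → C(X, X)) (c : ℝ) (m : ℕ) :
    (transfer f ^ m) (ContinuousMap.const X c) = ContinuousMap.const X c := by
  induction m with
  | zero => simp
  | succ m ih => rw [transfer_pow_succ_apply', ih, transfer_const]

theorem transfer_pow_le_const (f : ι → C(X, X)) {φ : C(X, ℝ)} {c : ℝ} (h : ∀ x, φ x ≤ c) (m : ℕ)
    (x : X) : (transfer f ^ m) φ x ≤ c := by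
  simpa [transfer_pow_const] using transfer_pow_mono f (φ := φ) (ψ := ContinuousMap.const X c)
    (K := Set.univ) (fun _ => Set.mapsTo_univ _ _) (fun y _ => h y) m x trivial

theorem const_le_transfer_pow (f : ι → C(X, X)) {φ : C(X, ℝ)} {c : ℝ} (h : ∀ x, c ≤ φ x) (m : ℕ)
    (x : X) : c ≤ (transfer f ^ m) φ x := by
  simpa [transfer_pow_const] using transfer_pow_mono f (ψ := φ) (φ := ContinuousMap.const X c)
    (K := Set.univ) (fun _ => Set.mapsTo_univ _ _) (fun y _ => h y) m x trivial

/-- The branches bring points closer by the factor q, so the modulus of continuity of φ at scale δ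
serves the m-th average at scale δ / q^m. -/
theorem transfer_pow_sub_le {f : ι → C(X, X)} {q : NNReal} (hf : ∀ i, LipschitzWith q (f i))
    {φ : C(X, ℝ)} {δ e : ℝ} (h : ∀ x y, dist x y ≤ δ → φ x - φ y ≤ e) (m : ℕ) :
    ∀ x y, q ^ m * dist x y ≤ δ → (transfer f ^ m) φ x - (transfer f ^ m) φ y ≤ e := by
  induction m with
  | zero => simpa using h
  | succ m ih =>
    intro x y hxy
    rw [transfer_pow_succ_apply', transfer_apply, transfer_apply, ← mul_sub,
      ← Finset.sum_sub_distrib]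
    have hc : (0 : ℝ) < Fintype.card ι := by exact_mod_cast Fintype.card_pos
    rw [inv_mul_le_iff₀ hc]
    calc _ ≤ ∑ _i : ι, e := by
          refine Finset.sum_le_sum fun i _ => ih _ _ ?_
          refine le_trans ?_ hxy
          rw [pow_succ, mul_assoc]
          gcongr
          exact (hf i).dist_le_mul x y
      _ = _ := by simp

theorem exists_transfer_pow_sub_le [CompactSpace X] {f : ι → C(X, X)} {q : NNReal} (hq : q < 1)
    (hf : ∀ i, LipschitzWith q (f i)) (φ : C(X, ℝ)) {e : ℝ} (he : 0 < e) :
    ∃ M : ℕ, ∀ x y, (transfer f ^ M) φ x - (transfer f ^ M) φ y ≤ e := by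
  obtain ⟨δ, hδ, h⟩ := Metric.uniformContinuous_iff.1
    (CompactSpace.uniformContinuous_of_continuous φ.continuous) e he
  obtain ⟨D, hD⟩ := Metric.isBounded_iff.1
    (Metric.isBounded_of_compactSpace (s := (Set.univ : Set X)))
  have hlim : Tendsto (fun m : ℕ => (q : ℝ) ^ m * D) atTop (𝓝 (0 * D)) :=
    (tendsto_pow_atTop_nhds_zero_of_lt_one q.2 (by exact_mod_cast hq)).mul_const D
  rw [zero_mul] at hlim
  obtain ⟨M, hM⟩ := (hlim.eventually (gt_mem_nhds (half_pos hδ))).exists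
  refine ⟨M, fun x y => transfer_pow_sub_le hf (δ := δ / 2) ?_ M x y ?_⟩
  · intro x y hxy
    have := h (lt_of_le_of_lt hxy (half_lt_self hδ))
    rw [Real.dist_eq] at this
    exact (le_abs_self _).trans this.le
  · refine le_trans ?_ hM.le
    gcongr
    exact hD trivial trivial

/-- Once the oscillation of an average is below e, further averaging stays between its extreme
values. Hence the averages are uniformly Cauchy and the limit does not depend on the point. -/
theorem exists_tendsto_transfer_pow [CompactSpace X] {f : ι → C(X, X)} {q : NNReal} (hq : q < 1)
    (hf : ∀ i, LipschitzWith q (f i)) (φ : C(X, ℝ)) :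
    ∃ c : ℝ, ∀ x, Tendsto (fun m : ℕ => (transfer f ^ m) φ x) atTop (𝓝 c) := by
  rcases isEmpty_or_nonempty X with hX | ⟨⟨x₀⟩⟩
  · exact ⟨0, fun x => hX.elim x⟩
  have key : ∀ e > 0, ∃ M : ℕ, ∀ m ≥ M, ∀ x y,
      |(transfer f ^ m) φ x - (transfer f ^ M) φ y| ≤ e := by
    intro e he
    obtain ⟨M, hM⟩ := exists_transfer_pow_sub_le hq hf φ he
    refine ⟨M, fun m hm x y => ?_⟩
    obtain ⟨p, rfl⟩ := Nat.exists_eq_add_of_le' hm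
    rw [pow_add, Module.End.mul_apply, abs_le]
    constructor
    · have := const_le_transfer_pow f (φ := (transfer f ^ M) φ) (c := (transfer f ^ M) φ y - e)
        (fun z => by linarith [hM y z]) p x
      linarith
    · have := transfer_pow_le_const f (φ := (transfer f ^ M) φ) (c := (transfer f ^ M) φ y + e)
        (fun z => by linarith [hM z y]) p x
      linarith
  have hc : CauchySeq (fun m : ℕ => (transfer f ^ m) φ x₀) := by
    rw [Metric.cauchySeq_iff']
    intro e he
    obtain ⟨M, hM⟩ := key (e / 2) (half_pos he)
    exact ⟨M, fun m hm => lt_of_le_of_lt (hM m hm x₀ x₀) (half_lt_self he)⟩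
  obtain ⟨c, hc⟩ := cauchySeq_tendsto_of_complete hc
  refine ⟨c, fun x => ?_⟩
  have h0 : Tendsto (fun m : ℕ => (transfer f ^ m) φ x - (transfer f ^ m) φ x₀) atTop (𝓝 0) := by
    rw [Metric.tendsto_atTop]
    intro e he
    obtain ⟨M, hM⟩ := key (e / 3) (by positivity)
    refine ⟨M, fun m hm => ?_⟩
    have h1 := abs_le.1 (hM m hm x x₀)
    have h2 := abs_le.1 (hM m hm x₀ x₀)
    rw [Real.dist_eq, sub_zero, abs_lt]
    constructor <;> linarith [h1.1, h1.2, h2.1, h2.2]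
  simpa using h0.add hc

-- The limit of the averages is a positive linear functional of φ with value 1 at the constant 1;
-- the Riesz theorem turns it into a probability measure.
open scoped CompactlySupported in
theorem exists_measure_tendsto_transfer_pow [CompactSpace X] [MeasurableSpace X] [BorelSpace X]
    [Nonempty X] {f : ι → C(X, X)} {q : NNReal} (hq : q < 1)
    (hf : ∀ i, LipschitzWith q (f i)) :
    ∃ μ : Measure X, IsProbabilityMeasure μ ∧ ∀ (φ : C(X, ℝ)) (x : X),
      Tendsto (fun m : ℕ => (transfer f ^ m) φ x) atTop (𝓝 (∫ y, φ y ∂μ)) := by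
  choose c hc using exists_tendsto_transfer_pow hq hf
  obtain ⟨x₀⟩ := ‹Nonempty X›
  let Λ : C_c(X, ℝ) →ₚ[ℝ] ℝ := PositiveLinearMap.mk₀
    { toFun := fun φ => c φ.toContinuousMap
      map_add' := fun φ ψ => by
        refine tendsto_nhds_unique (hc _ x₀) ?_
        have := (hc φ.toContinuousMap x₀).add (hc ψ.toContinuousMap x₀)
        refine this.congr fun m => ?_
        rw [← ContinuousMap.add_apply, ← map_add]
        rfl
      map_smul' := fun r φ => by
        refine tendsto_nhds_unique (hc _ x₀) ?_
        have := (hc φ.toContinuousMap x₀).const_mul r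
        refine this.congr fun m => ?_
        rw [← smul_eq_mul, ← ContinuousMap.smul_apply, ← map_smul]
        rfl } (fun φ hφ => by
        refine ge_of_tendsto' (hc φ.toContinuousMap x₀) fun m => ?_
        exact const_le_transfer_pow f (fun x => hφ x) m x₀)
  have hΛ : ∀ φ : C(X, ℝ), ∫ x, φ x ∂(RealRMK.rieszMeasure Λ) = c φ := fun φ =>
    RealRMK.integral_rieszMeasure Λ (CompactlySupportedContinuousMap.continuousMapEquiv φ)
  have h1 : c (ContinuousMap.const X 1) = 1 := by
    refine tendsto_nhds_unique (hc _ x₀) ?_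
    simp_rw [transfer_pow_const]
    exact tendsto_const_nhds
  refine ⟨RealRMK.rieszMeasure Λ, ⟨?_⟩, fun φ x => by rw [hΛ]; exact hc φ x⟩
  have := hΛ (ContinuousMap.const X 1)
  rw [h1] at this
  simp only [ContinuousMap.const_apply, integral_const, smul_eq_mul, mul_one, measureReal_def] at this
  exact (ENNReal.toReal_eq_one_iff _).1 this

end Transfer

section Support

variable {X ι : Type*} [MetricSpace X] [Fintype ι] [MeasurableSpace X] {f : ι → C(X, X)}
  {μ : Measure X}

theorem integral_transfer [Nonempty X] (hμ : ∀ (φ : C(X, ℝ)) (x : X),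
    Tendsto (fun m : ℕ => (transfer f ^ m) φ x) atTop (𝓝 (∫ y, φ y ∂μ))) (φ : C(X, ℝ)) :
    ∫ y, transfer f φ y ∂μ = ∫ y, φ y ∂μ := by
  obtain ⟨x₀⟩ := ‹Nonempty X›
  refine tendsto_nhds_unique (hμ (transfer f φ) x₀) ?_
  simp_rw [← transfer_pow_succ_apply]
  exact (tendsto_add_atTop_iff_nat 1).2 (hμ φ x₀)

variable [CompactSpace X] [BorelSpace X]

/-- The distance to K vanishes at all images of a point of K, so its limiting average, the integral,
is 0. -/
theorem support_subset_of_mapsTo [IsProbabilityMeasure μ] (hμ : ∀ (φ : C(X, ℝ)) (x : X),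
    Tendsto (fun m : ℕ => (transfer f ^ m) φ x) atTop (𝓝 (∫ y, φ y ∂μ)))
    {K : Set X} (hK : IsClosed K) (hne : K.Nonempty) (hfK : ∀ i, Set.MapsTo (f i) K K) :
    μ.support ⊆ K := by
  obtain ⟨a, ha⟩ := hne
  let φ : C(X, ℝ) := ⟨fun x => Metric.infDist x K, Metric.continuous_infDist_pt K⟩
  have hφ : ∀ x ∈ K, φ x ≤ ContinuousMap.const X 0 x := fun x hx => by
    simp [φ, Metric.infDist_zero_of_mem hx]
  have hint : ∫ y, φ y ∂μ ≤ 0 := by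
    refine le_of_tendsto' (hμ φ a) fun m => ?_
    simpa [transfer_pow_const] using transfer_pow_mono f hfK hφ m a ha
  have hint0 : ∫ y, φ y ∂μ = 0 := le_antisymm hint (integral_nonneg fun x => Metric.infDist_nonneg)
  have hae := (integral_eq_zero_iff_of_nonneg (fun x => Metric.infDist_nonneg)
    (φ.continuous.integrable_of_hasCompactSupport (HasCompactSupport.of_compactSpace _))).1 hint0
  refine Measure.support_subset_of_isClosed hK ?_
  filter_upwards [hae] with x hx
  exact (hK.mem_iff_infDist_zero ⟨a, ha⟩).2 hx

variable [Nonempty ι]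

/-- The distance to the support has integral 0, hence so has its average over the branches. That
average is continuous and non-negative, so it vanishes on the support, and with it each of its
summands. -/
theorem mapsTo_support [IsProbabilityMeasure μ] (hμ : ∀ (φ : C(X, ℝ)) (x : X),
    Tendsto (fun m : ℕ => (transfer f ^ m) φ x) atTop (𝓝 (∫ y, φ y ∂μ))) (i : ι) :
    Set.MapsTo (f i) μ.support μ.support := by
  intro x hx
  by_contra hfx
  have hX : Nonempty X := ⟨x⟩
  have hcl : IsClosed μ.support := Measure.isClosed_support
  let φ : C(X, ℝ) := ⟨fun y => Metric.infDist y μ.support, Metric.continuous_infDist_pt _⟩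
  have hint : ∀ ψ : C(X, ℝ), Integrable ψ μ := fun ψ =>
    ψ.continuous.integrable_of_hasCompactSupport (HasCompactSupport.of_compactSpace _)
  have h0 : ∫ y, φ y ∂μ = 0 := by
    refine integral_eq_zero_of_ae ?_
    filter_upwards [Measure.support_mem_ae (μ := μ)] with y hy
    exact Metric.infDist_zero_of_mem hy
  rw [← integral_transfer hμ φ] at h0
  have hnn : ∀ y, 0 ≤ transfer f φ y := fun y => by
    rw [transfer_apply]
    exact mul_nonneg (by positivity) (Finset.sum_nonneg fun i _ => Metric.infDist_nonneg)
  have hae := (integral_eq_zero_iff_of_nonneg hnn (hint _)).1 h0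
  have hsub : μ.support ⊆ {y | transfer f φ y = 0} :=
    Measure.support_subset_of_isClosed (isClosed_eq (transfer f φ).continuous continuous_const) hae
  have hx0 : transfer f φ x = 0 := hsub hx
  rw [transfer_apply, mul_eq_zero, Finset.sum_eq_zero_iff_of_nonneg
    (fun i _ => show 0 ≤ φ (f i x) from Metric.infDist_nonneg)] at hx0
  rcases hx0 with h | h
  · simp at h
  · exact hfx ((hcl.mem_iff_infDist_zero ⟨x, hx⟩).2 (h i (Finset.mem_univ i)))

/-- The union of the images of the support is closed and forward invariant, so minimality of the
support applies to it. -/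
theorem exists_mem_support_eq [IsProbabilityMeasure μ] (hμ : ∀ (φ : C(X, ℝ)) (x : X),
    Tendsto (fun m : ℕ => (transfer f ^ m) φ x) atTop (𝓝 (∫ y, φ y ∂μ))) {x : X}
    (hx : x ∈ μ.support) : ∃ i, ∃ y ∈ μ.support, f i y = x := by
  have hcl : IsClosed (⋃ i, f i '' μ.support) := isClosed_iUnion_of_finite fun i =>
    ((Measure.isClosed_support (μ := μ)).isCompact.image (f i).continuous).isClosed
  have := support_subset_of_mapsTo hμ hcl (by
    obtain ⟨i⟩ := ‹Nonempty ι›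
    exact ⟨f i x, Set.mem_iUnion.2 ⟨i, x, hx, rfl⟩⟩) (fun i y hy => by
    obtain ⟨j, z, hz, rfl⟩ := Set.mem_iUnion.1 hy
    exact Set.mem_iUnion.2 ⟨i, f j z, mapsTo_support hμ j hz, rfl⟩) hx
  obtain ⟨i, y, hy, rfl⟩ := Set.mem_iUnion.1 this
  exact ⟨i, y, hy, rfl⟩

end Support

end IFS

/-! ### Brouwer's characterization of the Cantor space. -/

namespace CantorSpace

open TopologicalSpace

variable {X : Type*} [TopologicalSpace X]

/-- If C cuts A, split along C. Otherwise perfectness provides a second point of A and total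
separation a clopen set between the two. -/
theorem exists_clopens_split [CompactSpace X] [T2Space X] [TotallyDisconnectedSpace X]
    [PerfectSpace X] (C A : Clopens X) (hA : (A : Set X).Nonempty) :
    ∃ B : Clopens X, B ≤ A ∧ (B : Set X).Nonempty ∧ ((A \ B : Clopens X) : Set X).Nonempty ∧
      (B ≤ C ∨ Disjoint B C) ∧ (A \ B ≤ C ∨ Disjoint (A \ B) C) := by
  by_cases h : ((A ⊓ C : Clopens X) : Set X).Nonempty ∧ ((A \ C : Clopens X) : Set X).Nonempty
  · refine ⟨A ⊓ C, inf_le_left, h.1, ?_, Or.inl inf_le_right, Or.inr ?_⟩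
    · rw [sdiff_inf_self_left]; exact h.2
    · rw [sdiff_inf_self_left]; exact disjoint_sdiff_self_left
  · have hAC : A ≤ C ∨ Disjoint A C := by
      rw [not_and_or] at h
      rcases h with h | h
      · right
        rw [disjoint_iff]
        ext x
        simpa using Set.ext_iff.1 (Set.not_nonempty_iff_eq_empty.1 h) x
      · left
        intro x hx
        by_contra hxC
        exact h ⟨x, hx, hxC⟩
    obtain ⟨x, hx⟩ := hA
    have hne : (𝓝[≠] x).NeBot := inferInstance
    obtain ⟨y, hyA, hyx⟩ : ∃ y, y ∈ (A : Set X) ∧ y ≠ x := by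
      have := (A.isClopen.isOpen.mem_nhds hx)
      obtain ⟨y, hy⟩ := hne.nonempty_of_mem (inter_mem_nhdsWithin {x}ᶜ this)
      exact ⟨y, hy.2, hy.1⟩
    have : TotallySeparatedSpace X := inferInstance
    obtain ⟨U, hU, hxU, hyU⟩ := exists_isClopen_of_totally_separated hyx.symm
    let U' : Clopens X := ⟨U, hU⟩
    refine ⟨A ⊓ U', inf_le_left, ⟨x, hx, hxU⟩, ⟨y, hyA, fun h => hyU h.2⟩, ?_, ?_⟩
    · exact hAC.imp (inf_le_left.trans ·) (·.mono_left inf_le_left)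
    · exact hAC.imp (sdiff_le.trans ·) (·.mono_left sdiff_le)

/-- The half selected by `b` of the `n`-th splitting of the clopen set `A`. -/
def half (s : ℕ → Clopens X → Clopens X) (n : ℕ) (A : Clopens X) (b : Bool) : Clopens X :=
  if b then s n A else A \ s n A

/-- The clopen set with address `ω 0, …, ω (n - 1)`. -/
def cell (s : ℕ → Clopens X → Clopens X) (ω : ℕ → Bool) : ℕ → Clopens X
  | 0 => ⊤
  | n + 1 => half s n (cell s ω n) (ω n)

open Classical in
/-- The clopen set of level `n` containing `x`. -/
def cellAt (s : ℕ → Clopens X → Clopens X) (x : X) : ℕ → Clopens X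
  | 0 => ⊤
  | n + 1 => half s n (cellAt s x n) (decide (x ∈ s n (cellAt s x n)))

open Classical in
/-- The sequence of halves containing `x`. -/
def address (s : ℕ → Clopens X → Clopens X) (x : X) (n : ℕ) : Bool :=
  decide (x ∈ s n (cellAt s x n))

variable {s : ℕ → Clopens X → Clopens X}

theorem cellAt_eq (x : X) (n : ℕ) : cellAt s x n = cell s (address s x) n := by
  induction n with
  | zero => rfl
  | succ n ih => simp only [cellAt, cell, ← ih]; rfl

theorem half_le (hs : ∀ n A, s n A ≤ A) (n : ℕ) (A : Clopens X) (b : Bool) : half s n A b ≤ A := by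
  cases b
  · exact sdiff_le
  · exact hs n A

theorem mem_half_iff (n : ℕ) {A : Clopens X} {x : X} (hx : x ∈ A) (b : Bool) :
    x ∈ half s n A b ↔ (b = true ↔ x ∈ s n A) := by
  cases b
  · simp only [half, Bool.false_eq_true, if_false, false_iff]
    exact ⟨fun h => h.2, fun h => ⟨hx, h⟩⟩
  · simp [half]

theorem mem_cellAt (x : X) (n : ℕ) : x ∈ cellAt s x n := by
  induction n with
  | zero => trivial
  | succ n ih => rw [cellAt, mem_half_iff n ih]; simp

theorem cell_eq_cellAt (hs : ∀ n A, s n A ≤ A) (ω : ℕ → Bool) (x : X) (n : ℕ)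
    (hx : x ∈ cell s ω n) : cell s ω n = cellAt s x n ∧ ∀ m < n, ω m = address s x m := by
  induction n with
  | zero => exact ⟨rfl, by simp⟩
  | succ n ih =>
    obtain ⟨h1, h2⟩ := ih (half_le hs _ _ _ hx)
    have hmem : x ∈ cell s ω n := half_le hs _ _ _ hx
    have h3 : ω n = address s x n := by
      have := (mem_half_iff n hmem (ω n)).1 hx
      rw [h1] at this
      rw [address, Bool.eq_iff_iff, this]
      simp
    refine ⟨by rw [cell, cellAt, h1, h3]; rfl, fun m hm => ?_⟩
    rcases Nat.lt_succ_iff_lt_or_eq.1 hm with h | rfl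
    · exact h2 m h
    · exact h3

/-- **Brouwer's theorem**: a non-empty compact perfect totally disconnected second countable
Hausdorff space is homeomorphic to the Cantor space. -/
theorem nonempty_homeomorph (X : Type*) [TopologicalSpace X] [CompactSpace X] [T2Space X]
    [TotallyDisconnectedSpace X] [SecondCountableTopology X] [PerfectSpace X] [Nonempty X] :
    Nonempty (X ≃ₜ (ℕ → Bool)) := by
  have hcount : Countable (Clopens X) := Clopens.countable_iff_secondCountable.2 inferInstance
  -- All clopen sets are enumerated, and the n-th splitting respects `C n`; so a clopen set
  -- separating two points separates their addresses.
  obtain ⟨C, hC⟩ := exists_surjective_nat (Clopens X)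
  have hsplit : ∀ (n : ℕ) (A : Clopens X), ∃ B : Clopens X, B ≤ A ∧ ((A : Set X).Nonempty →
      (B : Set X).Nonempty ∧ ((A \ B : Clopens X) : Set X).Nonempty ∧
      (B ≤ C n ∨ Disjoint B (C n)) ∧ (A \ B ≤ C n ∨ Disjoint (A \ B) (C n))) := by
    intro n A
    by_cases hA : (A : Set X).Nonempty
    · obtain ⟨B, h1, h2⟩ := exists_clopens_split (C n) A hA
      exact ⟨B, h1, fun _ => h2⟩
    · exact ⟨A, le_rfl, fun h => absurd h hA⟩
  choose s hs hs' using hsplit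
  have hhalf_ne : ∀ n (A : Clopens X) b, (A : Set X).Nonempty → (half s n A b : Set X).Nonempty := by
    intro n A b hA
    cases b
    · exact (hs' n A hA).2.1
    · exact (hs' n A hA).1
  have hhalf_sep : ∀ n (A : Clopens X) b, (A : Set X).Nonempty → half s n A b ≤ C n ∨
      Disjoint (half s n A b) (C n) := by
    intro n A b hA
    cases b
    · exact (hs' n A hA).2.2.2
    · exact (hs' n A hA).2.2.1
  have hne : ∀ ω n, (cell s ω n : Set X).Nonempty := by
    intro ω n
    induction n with
    | zero => exact Set.univ_nonempty
    | succ n ih => exact hhalf_ne _ _ _ ih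
  have hcont : Continuous (address s) := by
    refine continuous_pi fun n => IsLocallyConstant.continuous
      ((IsLocallyConstant.iff_eventually_eq _).2 fun x => ?_)
    filter_upwards [(cellAt s x (n + 1)).isClopen.isOpen.mem_nhds (mem_cellAt x (n + 1))] with y hy
    have hy' : y ∈ cell s (address s x) (n + 1) := by rw [← cellAt_eq]; exact hy
    exact ((cell_eq_cellAt hs _ y _ hy').2 n n.lt_succ_self).symm
  have hinj : Function.Injective (address s) := by
    intro x y hxy
    by_contra hne'
    have : TotallySeparatedSpace X := inferInstance
    obtain ⟨U, hU, hxU, hyU⟩ := exists_isClopen_of_totally_separated hne'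
    obtain ⟨n, hn⟩ := hC ⟨U, hU⟩
    have hx := mem_cellAt (s := s) x (n + 1)
    have hy := mem_cellAt (s := s) y (n + 1)
    rw [cellAt_eq] at hx hy
    rw [← hxy] at hy
    rcases hhalf_sep n _ (address s x n) (hne (address s x) n) with h | h
    · have := h hy
      rw [hn] at this
      exact hyU this
    · have hxC : x ∈ C n := by rw [hn]; exact hxU
      have : x ∈ (half s n (cell s (address s x) n) (address s x n) ⊓ C n : Clopens X) :=
        ⟨hx, hxC⟩
      rw [disjoint_iff.1 h] at this
      exact this
  have hsurj : Function.Surjective (address s) := by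
    intro ω
    -- The cells along ω are nested, compact and non-empty; a common point has address ω.
    obtain ⟨x, hx⟩ := IsCompact.nonempty_iInter_of_sequence_nonempty_isCompact_isClosed
      (fun n => (cell s ω n : Set X)) (fun n => half_le hs _ _ _) (hne ω)
      (cell s ω 0).isClopen.isClosed.isCompact (fun n => (cell s ω n).isClopen.isClosed)
    refine ⟨x, funext fun n => ?_⟩
    exact ((cell_eq_cellAt hs ω x (n + 1) (Set.mem_iInter.1 hx (n + 1))).2 n n.lt_succ_self).symm
  exact ⟨(hcont.homeoOfEquivCompactToT2 (f := Equiv.ofBijective _ ⟨hinj, hsurj⟩))⟩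

end CantorSpace

/-! ### Self-similar sets of small contraction ratio. -/

namespace IFS

/-- If `S` is covered by the images of `N` self-maps which are `q`-Lipschitz on `S`, then it is
covered by `N ^ m` sets of diameter at most `q ^ m * D`. -/
theorem exists_finset_cover {E ι : Type*} [PseudoMetricSpace E] [Fintype ι] {f : ι → E → E}
    {S : Set E} {q : NNReal} {D : ℝ} (hf : ∀ i, LipschitzOnWith q (f i) S)
    (hmaps : ∀ i, Set.MapsTo (f i) S S) (hsurj : ∀ x ∈ S, ∃ i, ∃ y ∈ S, f i y = x)
    (hD : ∀ x ∈ S, ∀ y ∈ S, dist x y ≤ D) (m : ℕ) :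
    ∃ s : Finset (Set E), s.card ≤ Fintype.card ι ^ m ∧ S ⊆ ⋃₀ (s : Set (Set E)) ∧
      ∀ A ∈ s, A ⊆ S ∧ ∀ x ∈ A, ∀ y ∈ A, dist x y ≤ q ^ m * D := by
  classical
  induction m with
  | zero => exact ⟨{S}, by simp, by simp, by simpa using hD⟩
  | succ m ih =>
    obtain ⟨s, hs, hS, hA⟩ := ih
    refine ⟨Finset.univ.biUnion fun i => s.image (f i '' ·), ?_, ?_, ?_⟩
    · calc _ ≤ ∑ i : ι, (s.image (f i '' ·)).card := Finset.card_biUnion_le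
        _ ≤ ∑ _i : ι, Fintype.card ι ^ m :=
          Finset.sum_le_sum fun i _ => Finset.card_image_le.trans hs
        _ = _ := by simp [pow_succ, mul_comm]
    · intro x hx
      obtain ⟨i, y, hy, rfl⟩ := hsurj x hx
      obtain ⟨A, hAs, hyA⟩ := hS hy
      refine ⟨f i '' A, ?_, y, hyA, rfl⟩
      simp only [Finset.coe_biUnion, Finset.coe_univ, Set.mem_univ, Set.iUnion_true,
        Set.mem_iUnion, Finset.coe_image]
      exact ⟨i, A, hAs, rfl⟩
    · intro B hB
      simp only [Finset.mem_biUnion, Finset.mem_univ, true_and, Finset.mem_image] at hB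
      obtain ⟨i, A, hAs, rfl⟩ := hB
      refine ⟨?_, ?_⟩
      · rintro _ ⟨x, hx, rfl⟩
        exact hmaps i ((hA A hAs).1 hx)
      · rintro _ ⟨x, hx, rfl⟩ _ ⟨y, hy, rfl⟩
        refine ((hf i).dist_le_mul x ((hA A hAs).1 hx) y ((hA A hAs).1 hy)).trans ?_
        rw [pow_succ', mul_assoc]
        gcongr
        exact (hA A hAs).2 x hx y hy

/-- A self-similar set with similarity dimension less than one is totally disconnected. -/
theorem isTotallyDisconnected {E ι : Type*} [MetricSpace E] [Fintype ι] {f : ι → E → E}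
    {S : Set E} {q : NNReal} (hq : Fintype.card ι * q < 1)
    (hf : ∀ i, LipschitzOnWith q (f i) S)
    (hmaps : ∀ i, Set.MapsTo (f i) S S) (hsurj : ∀ x ∈ S, ∃ i, ∃ y ∈ S, f i y = x)
    (hS : Bornology.IsBounded S) : IsTotallyDisconnected S := by
  obtain ⟨D, hD⟩ := Metric.isBounded_iff.1 hS
  intro C hCS hC x hx y hy
  by_contra hxy
  -- The distance to x is 1-Lipschitz and maps a connected set containing x and y onto a set
  -- containing [0, dist x y]. The covers of S bound the length of this interval by (|ι| q)^m D,
  -- which tends to 0.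
  let g : E → ℝ := fun z => dist x z
  have hgC : Set.Icc 0 (dist x y) ⊆ g '' S := by
    have h1 : IsPreconnected (g '' C) := hC.image g (by fun_prop)
    have h2 := h1.Icc_subset (a := 0) (b := dist x y) ⟨x, hx, dist_self x⟩ ⟨y, hy, rfl⟩
    exact h2.trans (Set.image_mono hCS)
  have hbound : ∀ m : ℕ, dist x y ≤ (Fintype.card ι * q : ℝ) ^ m * D := by
    intro m
    obtain ⟨s, hs, hcov, hA⟩ := exists_finset_cover hf hmaps hsurj (fun x hx y hy => hD hx hy) m
    have hD0 : 0 ≤ D := dist_nonneg.trans (hD (hCS hx) (hCS hx))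
    have hvol : ENNReal.ofReal (dist x y) ≤ ENNReal.ofReal ((Fintype.card ι * q : ℝ) ^ m * D) :=
      calc ENNReal.ofReal (dist x y) = volume (Set.Icc 0 (dist x y)) := by simp
        _ ≤ volume (⋃ A ∈ s, g '' A) := by
          refine measure_mono (hgC.trans ?_)
          rintro _ ⟨z, hz, rfl⟩
          obtain ⟨A, hAs, hzA⟩ := hcov hz
          exact Set.mem_biUnion hAs ⟨z, hzA, rfl⟩
        _ ≤ ∑ A ∈ s, volume (g '' A) := measure_biUnion_finset_le _ _
        _ ≤ ∑ _A ∈ s, ENNReal.ofReal (q ^ m * D) := by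
          refine Finset.sum_le_sum fun A hAs => (Real.volume_le_diam _).trans ?_
          refine Metric.ediam_le ?_
          rintro _ ⟨z, hz, rfl⟩ _ ⟨w, hw, rfl⟩
          rw [edist_dist]
          refine ENNReal.ofReal_le_ofReal (le_trans ?_ ((hA A hAs).2 z hz w hw))
          rw [Real.dist_eq]
          change |dist x z - dist x w| ≤ _
          rw [dist_comm x z, dist_comm x w]
          exact abs_dist_sub_le _ _ _
        _ = s.card * ENNReal.ofReal (q ^ m * D) := by simp
        _ ≤ ((Fintype.card ι ^ m : ℕ) : ENNReal) * ENNReal.ofReal (q ^ m * D) := by gcongr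
        _ = _ := by
          rw [← ENNReal.ofReal_natCast, ← ENNReal.ofReal_mul (by positivity)]
          push_cast
          rw [mul_pow, mul_assoc]
    exact (ENNReal.ofReal_le_ofReal_iff (by positivity)).1 hvol
  have hlim : Tendsto (fun m : ℕ => (Fintype.card ι * q : ℝ) ^ m * D) atTop (𝓝 (0 * D)) :=
    (tendsto_pow_atTop_nhds_zero_of_lt_one (by positivity) (by exact_mod_cast hq)).mul_const D
  have := ge_of_tendsto' hlim hbound
  rw [zero_mul] at this
  exact hxy (dist_le_zero.1 this)

theorem exists_wordMap_eq {E ι : Type*} {f : ι → E → E} {S : Set E}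
    (hsurj : ∀ x ∈ S, ∃ i, ∃ y ∈ S, f i y = x) (m : ℕ) :
    ∀ x ∈ S, ∃ l : List ι, l.length = m ∧ ∃ y ∈ S, wordMap f l y = x := by
  induction m with
  | zero => exact fun x hx => ⟨[], rfl, x, hx, rfl⟩
  | succ m ih =>
    intro x hx
    obtain ⟨i, y, hy, rfl⟩ := hsurj x hx
    obtain ⟨l, hl, z, hz, rfl⟩ := ih y hy
    exact ⟨i :: l, by simp [hl], z, hz, rfl⟩

theorem mapsTo_wordMap {E ι : Type*} {f : ι → E → E} {S : Set E}
    (hmaps : ∀ i, Set.MapsTo (f i) S S) (l : List ι) : Set.MapsTo (wordMap f l) S S := by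
  induction l with
  | nil => exact fun x hx => hx
  | cons i l ih => exact fun x hx => hmaps i (ih hx)

theorem lipschitzOnWith_wordMap {E ι : Type*} [PseudoMetricSpace E] {f : ι → E → E} {S : Set E}
    {q : NNReal} (hf : ∀ i, LipschitzOnWith q (f i) S) (hmaps : ∀ i, Set.MapsTo (f i) S S)
    (l : List ι) : LipschitzOnWith (q ^ l.length) (wordMap f l) S := by
  induction l with
  | nil =>
    rw [List.length_nil, pow_zero]
    exact LipschitzWith.id.lipschitzOnWith (s := S)
  | cons i l ih =>
    rw [List.length_cons, pow_succ']
    exact (hf i).comp ih (mapsTo_wordMap hmaps l)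

/-- This yields perfectness: every piece of the self-similar decomposition is infinite even if the
branches are only finite-to-one. -/
theorem infinite_image_wordMap {E ι : Type*} {f : ι → E → E} {S : Set E}
    (hmaps : ∀ i, Set.MapsTo (f i) S S) (hfib : ∀ i, ∀ y ∈ S, {z ∈ S | f i z = y}.Finite)
    (hS : S.Infinite) (l : List ι) : (wordMap f l '' S).Infinite := by
  induction l with
  | nil =>
    have : wordMap f [] '' S = S := Set.image_id S
    rwa [this]
  | cons i l ih =>
    intro hfin
    refine ih (Set.Finite.of_finite_fibers (f i) (hfin.subset ?_) ?_)
    · rintro _ ⟨_, ⟨x, hx, rfl⟩, rfl⟩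
      exact ⟨x, hx, rfl⟩
    · rintro _ ⟨_, ⟨x, hx, rfl⟩, rfl⟩
      refine (hfib i _ (hmaps i (mapsTo_wordMap hmaps l hx))).subset ?_
      rintro _ ⟨⟨z, hz, rfl⟩, hz'⟩
      exact ⟨mapsTo_wordMap hmaps l hz, hz'⟩

/-- An infinite self-similar set of similarity dimension less than one, all of whose defining
contractions are finite-to-one, is homeomorphic to the Cantor set. -/
theorem nonempty_homeomorph_cantorSet {E ι : Type*} [MetricSpace E] [Fintype ι] {f : ι → E → E}
    {S : Set E} {q : NNReal} (hq1 : q < 1) (hq : Fintype.card ι * q < 1)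
    (hf : ∀ i, LipschitzOnWith q (f i) S)
    (hmaps : ∀ i, Set.MapsTo (f i) S S) (hsurj : ∀ x ∈ S, ∃ i, ∃ y ∈ S, f i y = x)
    (hfib : ∀ i, ∀ y ∈ S, {z ∈ S | f i z = y}.Finite)
    (hS : IsCompact S) (hinf : S.Infinite) : Nonempty (S ≃ₜ cantorSet) := by
  have : CompactSpace S := isCompact_iff_compactSpace.1 hS
  have : TotallyDisconnectedSpace S := totallyDisconnectedSpace_subtype_iff.2
    (isTotallyDisconnected hq hf hmaps hsurj hS.isBounded)
  have : Nonempty S := hinf.nonempty.to_subtype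
  have : PerfectSpace S := by
    rw [perfectSpace_iff_forall_not_isolated]
    rintro ⟨x, hx⟩
    rw [← mem_closure_iff_nhdsWithin_neBot, Metric.mem_closure_iff]
    intro e he
    obtain ⟨D, hD⟩ := Metric.isBounded_iff.1 hS.isBounded
    have hlim : Tendsto (fun m : ℕ => (q : ℝ) ^ m * D) atTop (𝓝 (0 * D)) :=
      (tendsto_pow_atTop_nhds_zero_of_lt_one q.2 (by exact_mod_cast hq1)).mul_const D
    rw [zero_mul] at hlim
    obtain ⟨m, hm⟩ := (hlim.eventually (gt_mem_nhds he)).exists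
    -- The point x lies in a piece of diameter at most q^m D < e, and this infinite piece has a
    -- point other than x.
    obtain ⟨l, hl, y, hy, hyx⟩ := exists_wordMap_eq hsurj m x hx
    obtain ⟨_, ⟨z, hz, rfl⟩, hne⟩ := (infinite_image_wordMap hmaps hfib hinf l).exists_notMem_finite
      (Set.finite_singleton x)
    refine ⟨⟨wordMap f l z, mapsTo_wordMap hmaps l hz⟩, fun h => hne ?_, ?_⟩
    · simpa using h
    · rw [Subtype.dist_eq]
      simp only
      rw [← hyx]
      refine lt_of_le_of_lt ((lipschitzOnWith_wordMap hf hmaps l).dist_le_mul y hy z hz) ?_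
      refine lt_of_le_of_lt ?_ hm
      rw [hl]
      push_cast
      gcongr
      exact hD hy hz
  obtain ⟨e⟩ := CantorSpace.nonempty_homeomorph S
  exact ⟨e.trans cantorSetHomeomorphNatToBool.symm⟩

end IFS

/-! ### The normalized polynomials as small perturbations of Q_k. -/

namespace HolCorr

/-- The polynomial `∑ j, c j • Q j(w) (w - z)^(k - j)` in `w`. -/
def weighted (k : ℕ) (Q : ℕ → ℂ[X]) (c : ℕ → ℂ) (z : ℂ) : ℂ[X] :=
  ∑ j ∈ Finset.range (k + 1), C (c j) * (Q j * (X - C z) ^ (k - j))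

/-- The part of `weighted` coming from the indices `j < k`. -/
def perturbation (k : ℕ) (Q : ℕ → ℂ[X]) (c : ℕ → ℂ) (z w : ℂ) : ℂ :=
  ∑ j ∈ Finset.range k, c j * ((Q j).eval w * (w - z) ^ (k - j))

/-- Weights `c 0, …, c k = 1`, each of which is at most `η` times the next one. -/
structure SmallWeights (k : ℕ) (η : ℝ) (c : ℕ → ℂ) : Prop where
  top : c k = 1
  ne_zero : ∀ j ≤ k, c j ≠ 0
  le : ∀ j < k, ‖c j‖ ≤ η * ‖c (j + 1)‖

theorem SmallWeights.norm_le_one {k : ℕ} {η : ℝ} {c : ℕ → ℂ} (hc : SmallWeights k η c)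
    (hη : η ≤ 1) {j : ℕ} (hj : j ≤ k) : ‖c j‖ ≤ 1 := by
  induction hj using Nat.decreasingInduction with
  | self => simp [hc.top]
  | of_succ j hj ih =>
    calc ‖c j‖ ≤ η * ‖c (j + 1)‖ := hc.le j hj
      _ ≤ 1 * ‖c (j + 1)‖ := by gcongr
      _ ≤ 1 := by simpa using ih

theorem SmallWeights.norm_le {k : ℕ} {η : ℝ} {c : ℕ → ℂ} (hc : SmallWeights k η c)
    (hη0 : 0 ≤ η) (hη : η ≤ 1) {j : ℕ} (hj : j < k) : ‖c j‖ ≤ η :=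
  (hc.le j hj).trans (mul_le_of_le_one_right hη0 (hc.norm_le_one hη hj))

theorem eval_weighted (k : ℕ) (Q : ℕ → ℂ[X]) {c : ℕ → ℂ} (hc : c k = 1) (z w : ℂ) :
    (weighted k Q c z).eval w = (Q k).eval w + perturbation k Q c z w := by
  simp [weighted, perturbation, Finset.sum_range_succ, eval_finsetSum, hc, add_comm]

theorem norm_eval_le (p : ℂ[X]) :
    ∃ A : ℝ, 0 ≤ A ∧ ∀ w : ℂ, ‖p.eval w‖ ≤ A * (1 + ‖w‖) ^ p.natDegree := by
  refine ⟨∑ i ∈ Finset.range (p.natDegree + 1), ‖p.coeff i‖,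
    Finset.sum_nonneg fun i _ => norm_nonneg _, fun w => ?_⟩
  rw [eval_eq_sum_range, Finset.sum_mul]
  refine (norm_sum_le _ _).trans (Finset.sum_le_sum fun i hi => ?_)
  rw [norm_mul, norm_pow]
  gcongr
  calc ‖w‖ ^ i ≤ (1 + ‖w‖) ^ i := by gcongr; linarith
    _ ≤ _ := pow_le_pow_right₀ (by linarith [norm_nonneg w])
      (Nat.lt_succ_iff.1 (Finset.mem_range.1 hi))

theorem NonDegenerate.natDegree_add_le {k : ℕ} {Q : ℕ → ℂ[X]} (hT : NonDegenerate k Q) {j : ℕ}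
    (hj : j ≤ k) (h0 : Q j ≠ 0) : (Q j).natDegree + (k - j) ≤ (Q k).natDegree := by
  have := hT.2 j hj h0
  omega

/-- By non-degeneracy the total degree of each term in z and w is at most that of Q_k; the constant
A is uniform in the weights. -/
theorem norm_perturbation_le {k : ℕ} {Q : ℕ → ℂ[X]} (hT : NonDegenerate k Q) :
    ∃ A : ℝ, 0 ≤ A ∧ ∀ (η : ℝ) (c : ℕ → ℂ), 0 ≤ η → η ≤ 1 → SmallWeights k η c → ∀ z w : ℂ,
      ‖perturbation k Q c z w‖ ≤ η * (A * (1 + ‖w‖ + ‖z‖) ^ (Q k).natDegree) := by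
  choose A hA0 hA using norm_eval_le
  refine ⟨∑ j ∈ Finset.range k, A (Q j), Finset.sum_nonneg fun j _ => hA0 _,
    fun η c hη0 hη hc z w => ?_⟩
  rw [perturbation, Finset.sum_mul, Finset.mul_sum]
  refine (norm_sum_le _ _).trans (Finset.sum_le_sum fun j hj => ?_)
  have hj' : j < k := Finset.mem_range.1 hj
  have hz := norm_nonneg z
  have hw := norm_nonneg w
  by_cases h0 : Q j = 0
  · have : 0 ≤ η * (A (Q j) * (1 + ‖w‖ + ‖z‖) ^ (Q k).natDegree) := by
      have := hA0 (Q j)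
      positivity
    simpa [h0] using this
  rw [norm_mul, norm_mul, norm_pow]
  have h1 : ‖w - z‖ ≤ 1 + ‖w‖ + ‖z‖ := by linarith [norm_sub_le w z]
  have h2 := hA0 (Q j)
  calc ‖c j‖ * (‖(Q j).eval w‖ * ‖w - z‖ ^ (k - j))
      ≤ η * (A (Q j) * (1 + ‖w‖ + ‖z‖) ^ (Q j).natDegree * (1 + ‖w‖ + ‖z‖) ^ (k - j)) := by
        gcongr
        · exact hc.norm_le hη0 hη hj'
        · refine (hA (Q j) w).trans (mul_le_mul_of_nonneg_left (pow_le_pow_left₀ ?_ ?_ _) h2)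
          · positivity
          · linarith
    _ = η * (A (Q j) * (1 + ‖w‖ + ‖z‖) ^ ((Q j).natDegree + (k - j))) := by rw [pow_add]; ring
    _ ≤ _ := by
        gcongr
        · linarith
        · exact hT.natDegree_add_le hj'.le h0

theorem exists_lipschitz_perturbation (k : ℕ) (Q : ℕ → ℂ[X]) (R : ℝ) :
    ∃ L : ℝ, 0 ≤ L ∧ ∀ (η : ℝ) (c : ℕ → ℂ), 0 ≤ η → η ≤ 1 → SmallWeights k η c →
      ∀ z z' w w' : ℂ, ‖z‖ ≤ R → ‖z'‖ ≤ R → ‖w‖ ≤ R → ‖w'‖ ≤ R →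
        ‖perturbation k Q c z w - perturbation k Q c z' w'‖ ≤
          η * (L * (‖z - z'‖ + ‖w - w'‖)) := by
  have h : ∀ j, ∃ K : NNReal, LipschitzOnWith K
      (fun p : ℂ × ℂ => (Q j).eval p.2 * (p.2 - p.1) ^ (k - j))
      (Metric.closedBall 0 R ×ˢ Metric.closedBall 0 R) := by
    intro j
    refine ContDiffOn.exists_lipschitzOnWith (n := 1) ?_ one_ne_zero
      ((convex_closedBall _ _).prod (convex_closedBall _ _))
      ((isCompact_closedBall _ _).prod (isCompact_closedBall _ _))
    have h1 : ContDiff ℝ 1 (fun w : ℂ => (Q j).eval w) := by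
      have : ContDiff ℂ 1 (fun w : ℂ => aeval w (Q j)) := (Q j).contDiff_aeval 1
      simpa only [coe_aeval_eq_eval] using this.restrict_scalars ℝ
    exact ((h1.comp contDiff_snd).mul ((contDiff_snd.sub contDiff_fst).pow _)).contDiffOn
  choose K hK using h
  refine ⟨∑ j ∈ Finset.range k, (K j : ℝ), Finset.sum_nonneg fun j _ => (K j).2,
    fun η c hη0 hη hc z z' w w' hz hz' hw hw' => ?_⟩
  rw [perturbation, perturbation, ← Finset.sum_sub_distrib, Finset.sum_mul, Finset.mul_sum]
  refine (norm_sum_le _ _).trans (Finset.sum_le_sum fun j hj => ?_)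
  have hj' : j < k := Finset.mem_range.1 hj
  rw [← mul_sub, norm_mul]
  gcongr
  · exact hc.norm_le hη0 hη hj'
  · have := (hK j).dist_le_mul (z, w) (by simp [hz, hw]) (z', w') (by simp [hz', hw'])
    simp only [dist_eq_norm] at this
    refine this.trans ?_
    gcongr
    rw [Prod.mk_sub_mk, Prod.norm_mk]
    exact max_le (by linarith [norm_nonneg (w - w')]) (by linarith [norm_nonneg (z - z')])

/-- Factor p into linear terms. Applied to Q_k, this makes Q_k dominate the perturbation away from
its zeros. -/
theorem le_norm_eval_of_forall_root (p : ℂ[X]) {ρ : ℝ} (hρ : 0 ≤ ρ) {w : ℂ}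
    (h : ∀ u, p.IsRoot u → ρ ≤ ‖w - u‖) :
    ‖p.leadingCoeff‖ * ρ ^ p.natDegree ≤ ‖p.eval w‖ := by
  rcases eq_or_ne p 0 with rfl | hp
  · simp
  have hs := IsAlgClosed.splits p
  rw [hs.eval_eq_prod_roots, norm_mul, hs.natDegree_eq_card_roots]
  gcongr
  have key : ∀ s : Multiset ℂ, (∀ u ∈ s, ρ ≤ ‖w - u‖) →
      ρ ^ s.card ≤ ‖(s.map (fun u => w - u)).prod‖ := by
    intro s
    induction s using Multiset.induction with
    | empty => simp
    | cons a s ih =>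
      intro hs
      rw [Multiset.card_cons, pow_succ', Multiset.map_cons, Multiset.prod_cons, norm_mul]
      have h1 := hs a (Multiset.mem_cons_self a s)
      have h2 := ih fun u hu => hs u (Multiset.mem_cons_of_mem hu)
      gcongr
  exact key _ fun u hu => h u ((mem_roots hp).1 hu)

/-- For |w| ≥ max(|z|/2, R) both Q_k(w) and the bound for the perturbation are of order |w|^d, and
the factor η decides. The threshold for η precedes R, so R can be enlarged later. -/
theorem exists_root_norm_lt_max {k : ℕ} {Q : ℕ → ℂ[X]} (hT : NonDegenerate k Q) :
    ∃ R₀ : ℝ, 0 < R₀ ∧ ∃ η₀ > 0, η₀ ≤ 1 ∧ ∀ (η : ℝ) (c : ℕ → ℂ), 0 ≤ η → η ≤ η₀ →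
      SmallWeights k η c → ∀ R ≥ R₀, ∀ z w : ℂ, (weighted k Q c z).IsRoot w →
        ‖w‖ < max (‖z‖ / 2) R := by
  obtain ⟨A, hA0, hA⟩ := norm_perturbation_le hT
  set d := (Q k).natDegree
  have hlc : 0 < ‖(Q k).leadingCoeff‖ := norm_pos_iff.2 (leadingCoeff_ne_zero.2 hT.1)
  obtain ⟨B, hB⟩ : ∃ B : ℝ, ∀ u, (Q k).IsRoot u → ‖u‖ ≤ B := by
    have := ((Q k).roots.toFinset.finite_toSet).isBounded
    obtain ⟨B, hB⟩ := this.exists_norm_le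
    exact ⟨B, fun u hu => hB u (by simpa [hT.1] using hu)⟩
  -- For |w| ≥ 2B the zeros of Q_k are at distance at least |w|/2 from w, and |w| ≥ 1 gives 1 + |w|
  -- + |z| ≤ 4|w| = 8(|w|/2), whence the 8^d.
  refine ⟨max 1 (2 * B), lt_of_lt_of_le one_pos (le_max_left _ _),
    min 1 (‖(Q k).leadingCoeff‖ / (2 * (A * 8 ^ d + 1))), by positivity, min_le_left _ _,
    fun η c hη0 hη hc R hR z w hw => ?_⟩
  by_contra! hlt
  have h1 : 1 ≤ ‖w‖ := (le_max_left _ _).trans (hR.le.trans ((le_max_right _ _).trans hlt))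
  have h2 : 2 * B ≤ ‖w‖ := (le_max_right _ _).trans (hR.le.trans ((le_max_right _ _).trans hlt))
  have h3 : ‖z‖ ≤ 2 * ‖w‖ := by linarith [(le_max_left _ _).trans hlt]
  have hlow := le_norm_eval_of_forall_root (Q k) (ρ := ‖w‖ / 2) (w := w) (by positivity)
    (fun u hu => by linarith [norm_sub_norm_le w u, hB u hu])
  have hup := hA η c hη0 (hη.trans (min_le_left _ _)) hc z w
  have hroot : (Q k).eval w = - perturbation k Q c z w := by
    rw [IsRoot, eval_weighted k Q hc.top] at hw
    exact eq_neg_of_add_eq_zero_left hw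
  rw [hroot, norm_neg] at hlow
  have h4 : ‖(Q k).leadingCoeff‖ * (‖w‖ / 2) ^ d ≤ η * (A * (4 * ‖w‖) ^ d) := by
    refine hlow.trans (hup.trans ?_)
    gcongr
    linarith
  have h5 : (4 * ‖w‖) ^ d = 8 ^ d * (‖w‖ / 2) ^ d := by rw [← mul_pow]; ring_nf
  rw [h5, ← mul_assoc, ← mul_assoc, mul_assoc η] at h4
  have h6 := le_of_mul_le_mul_right h4 (by positivity)
  have h7 : η * (A * 8 ^ d) < ‖(Q k).leadingCoeff‖ := by
    calc η * (A * 8 ^ d) ≤ (‖(Q k).leadingCoeff‖ / (2 * (A * 8 ^ d + 1))) * (A * 8 ^ d + 1) := by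
          gcongr
          · exact hη.trans (min_le_right _ _)
          · linarith
      _ = ‖(Q k).leadingCoeff‖ / 2 := by
          have : A * 8 ^ d + 1 ≠ 0 := by positivity
          field_simp
      _ < _ := half_lt_self hlc
  linarith

theorem exists_root_near {k : ℕ} {Q : ℕ → ℂ[X]} (hT : NonDegenerate k Q) {ρ R : ℝ} (hρ : 0 < ρ) :
    ∃ η₀ > 0, ∀ (η : ℝ) (c : ℕ → ℂ), 0 ≤ η → η ≤ η₀ →
      SmallWeights k η c → ∀ z w : ℂ, ‖z‖ ≤ R → ‖w‖ ≤ R → (weighted k Q c z).IsRoot w →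
        ∃ u, (Q k).IsRoot u ∧ ‖w - u‖ < ρ := by
  obtain ⟨A, hA0, hA⟩ := norm_perturbation_le hT
  set d := (Q k).natDegree
  have hlc : 0 < ‖(Q k).leadingCoeff‖ := norm_pos_iff.2 (leadingCoeff_ne_zero.2 hT.1)
  set B := A * (1 + |R| + |R|) ^ d with hB
  have hB0 : 0 ≤ B := by positivity
  refine ⟨min 1 (‖(Q k).leadingCoeff‖ * ρ ^ d / (2 * (B + 1))), by positivity,
    fun η c hη0 hη hc z w hz hw hroot => ?_⟩
  by_contra! hfar
  have hlow := le_norm_eval_of_forall_root (Q k) hρ.le hfar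
  have hup := hA η c hη0 (hη.trans (min_le_left _ _)) hc z w
  have hroot : (Q k).eval w = - perturbation k Q c z w := by
    rw [IsRoot, eval_weighted k Q hc.top] at hroot
    exact eq_neg_of_add_eq_zero_left hroot
  rw [hroot, norm_neg] at hlow
  have h1 : ‖perturbation k Q c z w‖ ≤
      (‖(Q k).leadingCoeff‖ * ρ ^ d / (2 * (B + 1))) * (B + 1) := by
    refine hup.trans ?_
    gcongr
    · exact hη.trans (min_le_right _ _)
    · refine le_trans ?_ (le_add_of_nonneg_right zero_le_one)
      rw [hB]
      gcongr
      · exact hw.trans (le_abs_self R)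
      · exact hz.trans (le_abs_self R)
  have h2 : (‖(Q k).leadingCoeff‖ * ρ ^ d / (2 * (B + 1))) * (B + 1) =
      ‖(Q k).leadingCoeff‖ * ρ ^ d / 2 := by
    have : B + 1 ≠ 0 := by positivity
    field_simp
  have h3 : 0 < ‖(Q k).leadingCoeff‖ * ρ ^ d := by positivity
  linarith [hlow.trans h1]

/-- Strict differentiability at a simple zero gives expansion by |p'(u)|/2 nearby. -/
theorem exists_expanding_near_root {p : ℂ[X]} {u : ℂ} (hu : p.rootMultiplicity u = 1) :
    ∃ β > 0, ∃ r > 0, ∀ w ∈ Metric.ball u r, ∀ w' ∈ Metric.ball u r,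
      β * ‖w - w'‖ ≤ ‖p.eval w - p.eval w'‖ := by
  have hp : p ≠ 0 := by rintro rfl; simp at hu
  have hder : p.derivative.eval u ≠ 0 := by
    intro h
    have hroot : p.IsRoot u := (rootMultiplicity_pos hp).1 (by omega)
    have := (one_lt_rootMultiplicity_iff_isRoot hp).2 ⟨hroot, h⟩
    omega
  have hs : HasStrictDerivAt (fun w => p.eval w) (p.derivative.eval u) u := p.hasStrictDerivAt u
  have ho := hs.isLittleO.def (half_pos (norm_pos_iff.2 hder))
  rw [nhds_prod_eq] at ho
  obtain ⟨r, hr, h⟩ := Metric.mem_nhds_iff.1 (by rw [← nhds_prod_eq] at ho; exact ho)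
  refine ⟨_, half_pos (norm_pos_iff.2 hder), r, hr, fun w hw w' hw' => ?_⟩
  have hmem : ((w, w') : ℂ × ℂ) ∈ Metric.ball (u, u) r := by
    rw [← ball_prod_same]; exact ⟨hw, hw'⟩
  have h1 := h hmem
  simp only [Set.mem_ofPred_eq] at h1
  have h2 : ‖(w - w') • p.derivative.eval u‖ ≤ ‖p.eval w - p.eval w'‖ +
      ‖p.eval w - p.eval w' - (w - w') • p.derivative.eval u‖ := by
    have := norm_sub_le (p.eval w - p.eval w')
      (p.eval w - p.eval w' - (w - w') • p.derivative.eval u)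
    rwa [sub_sub_cancel] at this
  rw [norm_smul] at h2
  simp only [ContinuousLinearMap.toSpanSingleton_apply] at h1
  linarith

end HolCorr

/-! ### The zeros over a disc form contracting holomorphic branches. -/

namespace HolCorr

/-- The zeros of `weighted k Q c z` for `‖z‖ ≤ R` are within `ρ` of the zeros of `Q k`, they are
simple, and they depend on `z` in a `q`-Lipschitz way. -/
structure IsContracting (k : ℕ) (Q : ℕ → ℂ[X]) (c : ℕ → ℂ) (R ρ β q : ℝ) : Prop where
  natDegree_eq : ∀ z, (weighted k Q c z).natDegree = (Q k).natDegree
  norm_lt : ∀ z w, (weighted k Q c z).IsRoot w → ‖w‖ < max (‖z‖ / 2) R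
  near : ∀ z w, ‖z‖ ≤ R → (weighted k Q c z).IsRoot w → ∃ u, (Q k).IsRoot u ∧ w ∈ Metric.ball u ρ
  expand : ∀ z u, ‖z‖ ≤ R → (Q k).IsRoot u → ∀ w ∈ Metric.ball u ρ, ∀ w' ∈ Metric.ball u ρ,
    β * ‖w - w'‖ ≤ ‖(weighted k Q c z).eval w - (weighted k Q c z).eval w'‖
  lip : ∀ z z' w, ‖z‖ ≤ R → ‖z'‖ ≤ R → ‖w‖ ≤ R →
    ‖(weighted k Q c z).eval w - (weighted k Q c z').eval w‖ ≤ β * q * ‖z - z'‖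
  ball_disjoint : ∀ u u', (Q k).IsRoot u → (Q k).IsRoot u' → u ≠ u' → 2 * ρ ≤ ‖u - u'‖
  ball_subset : ∀ u, (Q k).IsRoot u → Metric.ball u ρ ⊆ Metric.ball 0 R

/-- The top coefficient does not involve z, so one smallness condition on the weights keeps the
degree equal to d for all z at once. -/
theorem coeff_mul_X_sub_C_pow {k : ℕ} {Q : ℕ → ℂ[X]} (hT : NonDegenerate k Q) {j : ℕ}
    (hj : j ≤ k) (z : ℂ) : (Q j * (X - C z) ^ (k - j)).coeff (Q k).natDegree =
      (Q j).coeff ((Q k).natDegree - (k - j)) := by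
  by_cases h0 : Q j = 0
  · simp [h0]
  have h := hT.natDegree_add_le hj h0
  have hm : ((X - C z) ^ (k - j)).Monic := (monic_X_sub_C z).pow _
  have hdeg : ((X - C z) ^ (k - j)).natDegree = k - j := by
    rw [(monic_X_sub_C z).natDegree_pow, natDegree_X_sub_C, mul_one]
  have := coeff_mul_add_eq_of_natDegree_le (f := Q j) (g := (X - C z) ^ (k - j))
    (df := (Q k).natDegree - (k - j)) (dg := k - j) (by omega) hdeg.le
  rw [show (Q k).natDegree - (k - j) + (k - j) = (Q k).natDegree by omega] at this
  have hm' := hm.coeff_natDegree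
  rw [hdeg] at hm'
  rw [this, hm', mul_one]

theorem natDegree_weighted_le {k : ℕ} {Q : ℕ → ℂ[X]} (hT : NonDegenerate k Q) (c : ℕ → ℂ) (z : ℂ) :
    (weighted k Q c z).natDegree ≤ (Q k).natDegree := by
  refine natDegree_sum_le_of_forall_le _ _ fun j hj => ?_
  have hj' : j ≤ k := Nat.lt_succ_iff.1 (Finset.mem_range.1 hj)
  by_cases h0 : Q j = 0
  · simp [h0]
  refine (natDegree_C_mul_le _ _).trans (natDegree_mul_le.trans ?_)
  rw [(monic_X_sub_C z).natDegree_pow, natDegree_X_sub_C, mul_one]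
  exact hT.natDegree_add_le hj' h0

theorem exists_natDegree_weighted_eq {k : ℕ} {Q : ℕ → ℂ[X]} (hT : NonDegenerate k Q) :
    ∃ η₀ > 0, ∀ (η : ℝ) (c : ℕ → ℂ), 0 ≤ η → η ≤ η₀ → SmallWeights k η c → ∀ z,
      (weighted k Q c z).natDegree = (Q k).natDegree := by
  have hlc : 0 < ‖(Q k).leadingCoeff‖ := norm_pos_iff.2 (leadingCoeff_ne_zero.2 hT.1)
  set B := ∑ j ∈ Finset.range k, ‖(Q j).coeff ((Q k).natDegree - (k - j))‖ with hB
  have hB0 : 0 ≤ B := Finset.sum_nonneg fun j _ => norm_nonneg _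
  refine ⟨min 1 (‖(Q k).leadingCoeff‖ / (2 * (B + 1))), by positivity, fun η c hη0 hη hc z =>
    natDegree_eq_of_le_of_coeff_ne_zero (natDegree_weighted_le hT c z) ?_⟩
  have h1 : (weighted k Q c z).coeff (Q k).natDegree = (Q k).leadingCoeff +
      ∑ j ∈ Finset.range k, c j * (Q j).coeff ((Q k).natDegree - (k - j)) := by
    rw [weighted, finsetSum_coeff, Finset.sum_range_succ, coeff_C_mul,
      coeff_mul_X_sub_C_pow hT le_rfl, hc.top, one_mul, Nat.sub_self, Nat.sub_zero, add_comm,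
      coeff_natDegree]
    congr 1
    refine Finset.sum_congr rfl fun j hj => ?_
    rw [coeff_C_mul, coeff_mul_X_sub_C_pow hT (Finset.mem_range.1 hj).le]
  have h2 : ‖∑ j ∈ Finset.range k, c j * (Q j).coeff ((Q k).natDegree - (k - j))‖ ≤
      (‖(Q k).leadingCoeff‖ / (2 * (B + 1))) * (B + 1) := by
    calc _ ≤ ∑ j ∈ Finset.range k, η * ‖(Q j).coeff ((Q k).natDegree - (k - j))‖ := by
          refine (norm_sum_le _ _).trans (Finset.sum_le_sum fun j hj => ?_)
          rw [norm_mul]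
          gcongr
          exact hc.norm_le hη0 (hη.trans (min_le_left _ _)) (Finset.mem_range.1 hj)
      _ = η * B := by rw [hB, Finset.mul_sum]
      _ ≤ _ := by
          gcongr
          · exact hη.trans (min_le_right _ _)
          · linarith
  have h3 : (‖(Q k).leadingCoeff‖ / (2 * (B + 1))) * (B + 1) = ‖(Q k).leadingCoeff‖ / 2 := by
    have : B + 1 ≠ 0 := by positivity
    field_simp
  rw [h1]
  intro h0
  rw [eq_neg_of_add_eq_zero_right h0, norm_neg] at h2
  linarith

theorem exists_isContracting {k : ℕ} {Q : ℕ → ℂ[X]} (hT : NonDegenerate k Q)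
    (hsimple : ∀ u : ℂ, (Q k).IsRoot u → (Q k).rootMultiplicity u = 1) {ε q : ℝ} (hε : 0 < ε)
    (hq : 0 < q) :
    ∃ ρ > 0, ρ ≤ ε ∧ ∃ R > 0, ∃ β > 0, ∃ η₀ > 0, ∀ (η : ℝ) (c : ℕ → ℂ), 0 ≤ η → η ≤ η₀ →
      SmallWeights k η c → IsContracting k Q c R ρ β q := by
  have hmem : ∀ u, u ∈ (Q k).roots.toFinset ↔ (Q k).IsRoot u := fun u => by simp [hT.1]
  -- One small number r serves as radius and as expansion constant, so that all requirements hold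
  -- for r close to 0.
  have h1 : ∀ᶠ r in 𝓝[>] (0 : ℝ), ∀ u ∈ (Q k).roots.toFinset, ∀ w ∈ Metric.ball u r,
      ∀ w' ∈ Metric.ball u r, r * ‖w - w'‖ ≤ ‖(Q k).eval w - (Q k).eval w'‖ := by
    refine (eventually_all_finset _).2 fun u hu => ?_
    obtain ⟨β, hβ, r, hr, h⟩ := exists_expanding_near_root (hsimple u ((hmem u).1 hu))
    filter_upwards [Ioo_mem_nhdsGT (lt_min hβ hr)] with s hs w hw w' hw'
    have hsr : s ≤ r := (hs.2.trans_le (min_le_right _ _)).le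
    have hsβ : s ≤ β := (hs.2.trans_le (min_le_left _ _)).le
    exact (mul_le_mul_of_nonneg_right hsβ (norm_nonneg _)).trans
      (h w (Metric.ball_subset_ball hsr hw) w' (Metric.ball_subset_ball hsr hw'))
  have h2 : ∀ᶠ r in 𝓝[>] (0 : ℝ), ∀ u ∈ (Q k).roots.toFinset, ∀ u' ∈ (Q k).roots.toFinset,
      u ≠ u' → 2 * r ≤ ‖u - u'‖ := by
    refine (eventually_all_finset _).2 fun u hu => (eventually_all_finset _).2 fun u' hu' => ?_
    by_cases h : u = u'
    · exact Eventually.of_forall fun r h' => absurd h h'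
    · have hpos : 0 < ‖u - u'‖ := norm_pos_iff.2 (sub_ne_zero.2 h)
      filter_upwards [Ioo_mem_nhdsGT (half_pos hpos)] with s hs _
      linarith [hs.2]
  obtain ⟨ρ, hρ1, hρ2, hρ⟩ := (h1.and (h2.and (Ioo_mem_nhdsGT hε))).exists
  obtain ⟨B, hB⟩ : ∃ B : ℝ, ∀ u, (Q k).IsRoot u → ‖u‖ ≤ B := by
    obtain ⟨B, hB⟩ := ((Q k).roots.toFinset.finite_toSet).isBounded.exists_norm_le
    exact ⟨B, fun u hu => hB u ((hmem u).2 hu)⟩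
  obtain ⟨R₀, hR₀, η₁, hη₁, hη₁', hnorm⟩ := exists_root_norm_lt_max hT
  set R := max R₀ (B + ρ)
  have hR : 0 < R := hR₀.trans_le (le_max_left _ _)
  obtain ⟨η₂, hη₂, hnear⟩ := exists_root_near hT (R := R) hρ.1
  obtain ⟨η₃, hη₃, hdeg⟩ := exists_natDegree_weighted_eq hT
  obtain ⟨L, hL, hlip⟩ := exists_lipschitz_perturbation k Q R
  have hsub : ∀ u, (Q k).IsRoot u → Metric.ball u ρ ⊆ Metric.ball 0 R := by
    intro u hu w hw
    rw [mem_ball_iff_norm] at hw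
    rw [mem_ball_zero_iff]
    have := norm_sub_norm_le w u
    have h3 := hB u hu
    have h4 : B + ρ ≤ R := le_max_right _ _
    linarith
  have hρ0 : 0 < ρ := hρ.1
  -- Q_k expands by ρ on the balls. A perturbation that is ρ/2-Lipschitz in w leaves β = ρ/2, and
  -- the last threshold makes it βq-Lipschitz in z. The 1 in L + 1 covers L = 0.
  refine ⟨ρ, hρ0, hρ.2.le, R, hR, ρ / 2, half_pos hρ0,
    min (min η₁ η₂) (min η₃ (min (ρ / 2 / (L + 1)) (ρ / 2 * q / (L + 1)))), by positivity,
    fun η c hη0 hη hc => ?_⟩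
  simp only [le_min_iff] at hη
  obtain ⟨⟨hη1, hη2⟩, hη3, hη4, hη5⟩ := hη
  have hηL : η * L ≤ ρ / 2 := by
    rw [le_div_iff₀ (by positivity)] at hη4
    nlinarith
  have hηL' : η * L ≤ ρ / 2 * q := by
    rw [le_div_iff₀ (by positivity)] at hη5
    nlinarith
  have hle : ∀ {w : ℂ}, w ∈ Metric.ball (0 : ℂ) R → ‖w‖ ≤ R := fun h =>
    (mem_ball_zero_iff.1 h).le
  refine ⟨hdeg η c hη0 hη3 hc,
    fun z w hw => hnorm η c hη0 hη1 hc R (le_max_left _ _) z w hw,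
    fun z w hz hw => ?_, fun z u hz hu w hw w' hw' => ?_, fun z z' w hz hz' hw => ?_,
    fun u u' hu hu' h => hρ2 u ((hmem u).2 hu) u' ((hmem u').2 hu') h, hsub⟩
  · have hwR : ‖w‖ ≤ R := by
      have := hnorm η c hη0 hη1 hc R (le_max_left _ _) z w hw
      rw [max_eq_right (by linarith [norm_nonneg z])] at this
      exact this.le
    obtain ⟨u, hu, h⟩ := hnear η c hη0 hη2 hc z w hz hwR hw
    exact ⟨u, hu, mem_ball_iff_norm.2 h⟩
  · have h3 := hρ1 u ((hmem u).2 hu) w hw w' hw'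
    have h4 := hlip η c hη0 (hη1.trans hη₁') hc z z w w' hz hz (hle (hsub u hu hw))
      (hle (hsub u hu hw'))
    rw [sub_self, norm_zero, zero_add, ← mul_assoc] at h4
    have h5 : ‖(Q k).eval w - (Q k).eval w'‖ ≤
        ‖(weighted k Q c z).eval w - (weighted k Q c z).eval w'‖ +
          ‖perturbation k Q c z w - perturbation k Q c z w'‖ := by
      rw [eval_weighted k Q hc.top, eval_weighted k Q hc.top]
      have h7 := norm_sub_le
        ((Q k).eval w + perturbation k Q c z w - ((Q k).eval w' + perturbation k Q c z w'))
        (perturbation k Q c z w - perturbation k Q c z w')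
      rwa [show (Q k).eval w + perturbation k Q c z w - ((Q k).eval w' + perturbation k Q c z w') -
        (perturbation k Q c z w - perturbation k Q c z w') = (Q k).eval w - (Q k).eval w' by
          ring] at h7
    have h6 : η * L * ‖w - w'‖ ≤ ρ / 2 * ‖w - w'‖ :=
      mul_le_mul_of_nonneg_right hηL (norm_nonneg _)
    linarith
  · have h4 := hlip η c hη0 (hη1.trans hη₁') hc z z' w w hz hz' hw hw
    rw [sub_self, norm_zero, add_zero, ← mul_assoc] at h4
    rw [eval_weighted k Q hc.top, eval_weighted k Q hc.top, add_sub_add_left_eq_sub]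
    exact h4.trans (mul_le_mul_of_nonneg_right hηL' (norm_nonneg _))

/-- A vanishing derivative would make increments o(|w' - w|), against expansion by β. -/
theorem IsContracting.derivative_ne_zero {k : ℕ} {Q : ℕ → ℂ[X]} {c : ℕ → ℂ} {R ρ β q : ℝ}
    (h : IsContracting k Q c R ρ β q) (hβ : 0 < β) {z u w : ℂ} (hz : ‖z‖ ≤ R) (hu : (Q k).IsRoot u)
    (hw : w ∈ Metric.ball u ρ) : (weighted k Q c z).derivative.eval w ≠ 0 := by
  intro h0
  have hd := (weighted k Q c z).hasDerivAt w
  rw [h0, hasDerivAt_iff_isLittleO] at hd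
  have h1 := hd.def (half_pos hβ)
  have h2 : ∀ᶠ w' in 𝓝[≠] w, False := by
    filter_upwards [h1.filter_mono nhdsWithin_le_nhds,
      mem_nhdsWithin_of_mem_nhds (Metric.isOpen_ball.mem_nhds hw), self_mem_nhdsWithin]
      with w' h3 h4 h5
    have h6 := h.expand z u hz hu w' h4 w hw
    rw [smul_zero, sub_zero] at h3
    have h7 : 0 < ‖w' - w‖ := norm_pos_iff.2 (sub_ne_zero.2 h5)
    nlinarith
  simpa using h2.exists

/-- The zeros of `Q k`, which index the branches of the correspondence. -/
abbrev RootIndex (k : ℕ) (Q : ℕ → ℂ[X]) : Type := {u : ℂ // u ∈ (Q k).roots.toFinset}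

theorem card_rootIndex {k : ℕ} {Q : ℕ → ℂ[X]}
    (hsimple : ∀ u : ℂ, (Q k).IsRoot u → (Q k).rootMultiplicity u = 1) :
    Fintype.card (RootIndex k Q) = (Q k).natDegree := by
  have hnd : (Q k).roots.Nodup := by
    rw [Multiset.nodup_iff_count_le_one]
    intro u
    rw [count_roots]
    by_cases hu : (Q k).IsRoot u
    · exact (hsimple u hu).le
    · rw [rootMultiplicity_eq_zero hu]; exact zero_le_one
  rw [Fintype.card_coe, Multiset.toFinset_card_of_nodup hnd,
    (IsAlgClosed.splits (Q k)).natDegree_eq_card_roots]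

theorem RootIndex.isRoot {k : ℕ} {Q : ℕ → ℂ[X]} (u : RootIndex k Q) : (Q k).IsRoot u :=
  isRoot_of_mem_roots (Multiset.mem_toFinset.1 u.2)

/-- Counting replaces the argument principle: the d zeros over z are simple, each lies in one of the
d balls, and expansion forbids two in the same ball, so zeros and balls correspond bijectively. -/
theorem IsContracting.exists_branches {k : ℕ} {Q : ℕ → ℂ[X]} {c : ℕ → ℂ} {R ρ β q : ℝ}
    (h : IsContracting k Q c R ρ β q) (hβ : 0 < β) (hQ : Q k ≠ 0) (hd : 1 ≤ (Q k).natDegree)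
    (hsimple : ∀ u : ℂ, (Q k).IsRoot u → (Q k).rootMultiplicity u = 1) {z : ℂ} (hz : ‖z‖ ≤ R) :
    ∃ f : RootIndex k Q → ℂ, (∀ u : RootIndex k Q, f u ∈ Metric.ball (u : ℂ) ρ) ∧
      (weighted k Q c z).roots = Finset.univ.val.map f := by
  classical
  set p := weighted k Q c z with hp
  have hp0 : p ≠ 0 := by
    intro h0
    have := h.natDegree_eq z
    rw [← hp, h0, natDegree_zero] at this
    omega
  have hnd : p.roots.Nodup := by
    rw [Multiset.nodup_iff_count_le_one]
    intro w
    rw [count_roots]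
    by_contra! hlt
    obtain ⟨h1, h2⟩ := (one_lt_rootMultiplicity_iff_isRoot hp0).1 hlt
    obtain ⟨u, hu, hwu⟩ := h.near z w hz h1
    exact h.derivative_ne_zero hβ hz hu hwu h2
  have hnear : ∀ w : {w // w ∈ p.roots.toFinset}, ∃ u : RootIndex k Q,
      (w : ℂ) ∈ Metric.ball (u : ℂ) ρ := by
    intro w
    obtain ⟨u, hu, hwu⟩ := h.near z w hz (isRoot_of_mem_roots (Multiset.mem_toFinset.1 w.2))
    exact ⟨⟨u, by simpa [hQ] using hu⟩, hwu⟩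
  choose g hg using hnear
  have hroot : ∀ w : {w // w ∈ p.roots.toFinset}, p.eval (w : ℂ) = 0 := fun w =>
    isRoot_of_mem_roots (Multiset.mem_toFinset.1 w.2)
  have hinj : Function.Injective g := by
    intro w w' hww
    have h1 := h.expand z (g w) hz (g w).isRoot w (hg w) w' (by rw [hww]; exact hg w')
    rw [← hp, hroot, hroot, sub_zero, norm_zero] at h1
    have h2 : ‖(w : ℂ) - w'‖ ≤ 0 := nonpos_of_mul_nonpos_right h1 hβ
    exact Subtype.ext (sub_eq_zero.1 (norm_le_zero_iff.1 h2))
  have hcard : Fintype.card {w // w ∈ p.roots.toFinset} = Fintype.card (RootIndex k Q) := by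
    rw [card_rootIndex hsimple, Fintype.card_coe, Multiset.toFinset_card_of_nodup hnd,
      ← h.natDegree_eq z, (IsAlgClosed.splits p).natDegree_eq_card_roots]
  let e := Equiv.ofBijective g ((Fintype.bijective_iff_injective_and_card g).2 ⟨hinj, hcard⟩)
  refine ⟨fun u => (e.symm u : ℂ), fun u => ?_, ?_⟩
  · have := hg (e.symm u)
    rwa [show g (e.symm u) = u from e.apply_symm_apply u] at this
  · refine (Multiset.Nodup.ext hnd ?_).2 fun w => ?_
    · exact (Finset.univ.nodup).map (Subtype.val_injective.comp e.symm.injective)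
    · simp only [Multiset.mem_map, Finset.mem_val, Finset.mem_univ, true_and]
      constructor
      · intro hw
        exact ⟨e ⟨w, Multiset.mem_toFinset.2 hw⟩, by simp⟩
      · rintro ⟨u, rfl⟩
        exact Multiset.mem_toFinset.1 (e.symm u).2

/-- With p_z the polynomial over z, β|w - w'| ≤ |p_z(w')| = |p_z(w') - p_{z'}(w')| ≤ βq|z - z'|. -/
theorem IsContracting.norm_sub_le {k : ℕ} {Q : ℕ → ℂ[X]} {c : ℕ → ℂ} {R ρ β q : ℝ}
    (h : IsContracting k Q c R ρ β q) (hβ : 0 < β) {z z' u w w' : ℂ} (hz : ‖z‖ ≤ R)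
    (hz' : ‖z'‖ ≤ R) (hu : (Q k).IsRoot u) (hw : w ∈ Metric.ball u ρ) (hw' : w' ∈ Metric.ball u ρ)
    (hr : (weighted k Q c z).IsRoot w) (hr' : (weighted k Q c z').IsRoot w') :
    ‖w - w'‖ ≤ q * ‖z - z'‖ := by
  have h1 := h.expand z u hz hu w hw w' hw'
  have h2 := h.lip z z' w' hz hz' (mem_ball_zero_iff.1 (h.ball_subset u hu hw')).le
  rw [hr.eq_zero, zero_sub, norm_neg] at h1
  rw [hr'.eq_zero, sub_zero] at h2
  rw [mul_assoc] at h2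
  exact le_of_mul_le_mul_left (h1.trans h2) hβ

/-- Implicit differentiation of Φ(z, f z) = 0: the branch is already Lipschitz, so the linearization
of Φ has error o(|z - z₀|) along its graph and can be solved for f, since ∂Φ/∂w ≠ 0. -/
theorem IsContracting.differentiableAt {k : ℕ} {Q : ℕ → ℂ[X]} {c : ℕ → ℂ} {R ρ β q : ℝ}
    (h : IsContracting k Q c R ρ β q) (hβ : 0 < β) {u : ℂ} (hu : (Q k).IsRoot u) {f : ℂ → ℂ}
    (hf : ∀ z, ‖z‖ ≤ R → f z ∈ Metric.ball u ρ ∧ (weighted k Q c z).IsRoot (f z)) {z₀ : ℂ}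
    (hz₀ : ‖z₀‖ < R) : DifferentiableAt ℂ f z₀ := by
  let Φ : ℂ × ℂ → ℂ := fun p => (weighted k Q c p.1).eval p.2
  have hΦd : DifferentiableAt ℂ Φ (z₀, f z₀) := by
    have : Φ = fun p : ℂ × ℂ => ∑ j ∈ Finset.range (k + 1),
        c j * ((Q j).eval p.2 * (p.2 - p.1) ^ (k - j)) := by
      ext p
      simp [Φ, weighted, eval_finsetSum]
    rw [this]
    refine DifferentiableAt.fun_sum fun j _ => (DifferentiableAt.mul ?_ ?_).const_mul _
    · exact (Q j).differentiable.differentiableAt.comp (f := fun p : ℂ × ℂ => p.2) _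
        differentiableAt_snd
    · exact (differentiableAt_snd.sub differentiableAt_fst).pow _
  obtain ⟨Φ', hΦ⟩ := hΦd
  have hb : Φ' (0, 1) = (weighted k Q c z₀).derivative.eval (f z₀) := by
    have h1 : HasDerivAt (fun w : ℂ => Φ (z₀, w)) (Φ' (0, 1)) (f z₀) :=
      hΦ.comp_hasDerivAt (f z₀) ((hasDerivAt_const (f z₀) z₀).prodMk (hasDerivAt_id (f z₀)))
    exact h1.unique ((weighted k Q c z₀).hasDerivAt (f z₀))
  have hb0 : Φ' (0, 1) ≠ 0 := by
    rw [hb]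
    exact h.derivative_ne_zero hβ hz₀.le hu (hf z₀ hz₀.le).1
  have hball : ∀ᶠ z in 𝓝 z₀, ‖z‖ < R := by
    have : Metric.ball (0 : ℂ) R ∈ 𝓝 z₀ := Metric.isOpen_ball.mem_nhds (mem_ball_zero_iff.2 hz₀)
    filter_upwards [this] with z hz using mem_ball_zero_iff.1 hz
  have hO : (fun z => ((z, f z) : ℂ × ℂ) - (z₀, f z₀)) =O[𝓝 z₀] fun z => z - z₀ := by
    refine Asymptotics.IsBigO.of_bound (max 1 q) ?_
    filter_upwards [hball] with z hz
    have h1 := h.norm_sub_le hβ hz.le hz₀.le hu (hf z hz.le).1 (hf z₀ hz₀.le).1 (hf z hz.le).2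
      (hf z₀ hz₀.le).2
    rw [Prod.mk_sub_mk, Prod.norm_mk]
    refine max_le ?_ (h1.trans ?_)
    · exact le_mul_of_one_le_left (norm_nonneg _) (le_max_left _ _)
    · exact mul_le_mul_of_nonneg_right (le_max_right _ _) (norm_nonneg _)
  have htend : Tendsto (fun z => ((z, f z) : ℂ × ℂ)) (𝓝 z₀) (𝓝 (z₀, f z₀)) := by
    rw [tendsto_iff_norm_sub_tendsto_zero]
    refine (hO.trans_tendsto ?_).norm.trans (by simp)
    exact tendsto_sub_nhds_zero_iff.2 tendsto_id
  have ho : (fun z => Φ' (((z, f z) : ℂ × ℂ) - (z₀, f z₀))) =o[𝓝 z₀] fun z => z - z₀ := by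
    have h1 := (hΦ.isLittleO.comp_tendsto htend).trans_isBigO hO
    refine (h1.neg_left).congr' ?_ EventuallyEq.rfl
    filter_upwards [hball] with z hz
    have h2 : Φ (z, f z) = 0 := (hf z hz.le).2
    have h3 : Φ (z₀, f z₀) = 0 := (hf z₀ hz₀.le).2
    simp only [Function.comp_apply, h2, h3, sub_self, zero_sub, neg_neg]
  refine HasDerivAt.differentiableAt (f' := -(Φ' (0, 1))⁻¹ * Φ' (1, 0)) ?_
  rw [hasDerivAt_iff_isLittleO]
  refine (ho.const_mul_left (Φ' (0, 1))⁻¹).congr (fun z => ?_) fun _ => rfl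
  have h4 : ((z, f z) : ℂ × ℂ) - (z₀, f z₀) = (z - z₀) • ((1, 0) : ℂ × ℂ) +
      (f z - f z₀) • ((0, 1) : ℂ × ℂ) := by simp
  rw [h4, map_add, map_smul, map_smul, smul_eq_mul, smul_eq_mul, smul_eq_mul]
  field_simp
  ring

end HolCorr

/-! ### Preimages under the correspondence and infinitude of invariant sets. -/

namespace HolCorr

/-- For fixed `w`, the value of `weighted k Q c z` at `w` as a polynomial in `w - z`. -/
def cofibre (k : ℕ) (Q : ℕ → ℂ[X]) (c : ℕ → ℂ) (w : ℂ) : ℂ[X] :=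
  ∑ i ∈ Finset.range (k + 1), C (c (k - i) * (Q (k - i)).eval w) * X ^ i

theorem coeff_cofibre (k : ℕ) (Q : ℕ → ℂ[X]) (c : ℕ → ℂ) (w : ℂ) {i : ℕ} (hi : i ≤ k) :
    (cofibre k Q c w).coeff i = c (k - i) * (Q (k - i)).eval w := by
  rw [cofibre, finsetSum_coeff]
  simp_rw [coeff_C_mul_X_pow]
  rw [Finset.sum_ite_eq, if_pos (Finset.mem_range.2 (Nat.lt_succ_iff.2 hi))]

theorem eval_cofibre (k : ℕ) (Q : ℕ → ℂ[X]) (c : ℕ → ℂ) (z w : ℂ) :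
    (cofibre k Q c w).eval (w - z) = (weighted k Q c z).eval w := by
  rw [cofibre, weighted, ← Finset.sum_range_reflect, eval_finsetSum, eval_finsetSum]
  refine Finset.sum_congr rfl fun j hj => ?_
  have hj' := Finset.mem_range.1 hj
  rw [show k + 1 - 1 - j = k - j by omega, show k - (k - j) = j by omega]
  simp [mul_assoc]

/-- The coefficients are c_j Q_j(w), and they vanish together only at a common zero of the Q_j. -/
theorem cofibre_ne_zero {k : ℕ} {Q : ℕ → ℂ[X]} {c : ℕ → ℂ} (hc : ∀ j ≤ k, c j ≠ 0)
    (hQ : ¬ ∃ a : ℂ, ∀ j ≤ k, (Q j).eval a = 0) (w : ℂ) : cofibre k Q c w ≠ 0 := by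
  intro h0
  refine hQ ⟨w, fun j hj => ?_⟩
  have h1 := coeff_cofibre k Q c w (i := k - j) (Nat.sub_le _ _)
  rw [h0, coeff_zero, show k - (k - j) = j by omega] at h1
  exact (mul_eq_zero.1 h1.symm).resolve_left (hc j hj)

theorem natDegree_cofibre_le (k : ℕ) (Q : ℕ → ℂ[X]) (c : ℕ → ℂ) (w : ℂ) :
    (cofibre k Q c w).natDegree ≤ k :=
  natDegree_sum_le_of_forall_le _ _ fun _ hi =>
    (natDegree_C_mul_X_pow_le _ _).trans (Nat.lt_succ_iff.1 (Finset.mem_range.1 hi))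

theorem natDegree_cofibre_le' {k : ℕ} {Q : ℕ → ℂ[X]} (hT : NonDegenerate k Q) (c : ℕ → ℂ) (w : ℂ) :
    (cofibre k Q c w).natDegree ≤ (Q k).natDegree := by
  rw [natDegree_le_iff_coeff_eq_zero]
  intro i hi
  rcases le_or_gt i k with hik | hik
  · rw [coeff_cofibre k Q c w hik]
    have : Q (k - i) = 0 := by
      by_contra h0
      have := hT.natDegree_add_le (Nat.sub_le k i) h0
      omega
    simp [this]
  · exact coeff_eq_zero_of_natDegree_lt ((natDegree_cofibre_le k Q c w).trans_lt hik)

theorem finite_cofibre {k : ℕ} {Q : ℕ → ℂ[X]} {c : ℕ → ℂ} (hc : ∀ j ≤ k, c j ≠ 0)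
    (hQ : ¬ ∃ a : ℂ, ∀ j ≤ k, (Q j).eval a = 0) (w : ℂ) :
    {z | (weighted k Q c z).IsRoot w}.Finite := by
  refine Set.Finite.of_finite_image (f := fun z => w - z)
    (((cofibre k Q c w).roots.toFinset.finite_toSet).subset ?_)
    (sub_right_injective.injOn)
  rintro _ ⟨z, hz, rfl⟩
  simp only [Finset.mem_coe, Multiset.mem_toFinset, mem_roots (cofibre_ne_zero hc hQ w)]
  rw [IsRoot, eval_cofibre]
  exact hz

/-- Used for Q_{k-d+1} near the zeros of Q_k; r is both the radius and the lower bound. -/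
theorem exists_forall_le_norm_eval (p : ℂ[X]) (s : Finset ℂ) :
    ∃ r > 0, ∀ u ∈ s, p.eval u ≠ 0 → ∀ w ∈ Metric.ball u r, r ≤ ‖p.eval w‖ := by
  have h : ∀ᶠ r in 𝓝[>] (0 : ℝ), ∀ u ∈ s, p.eval u ≠ 0 → ∀ w ∈ Metric.ball u r,
      r ≤ ‖p.eval w‖ := by
    refine (eventually_all_finset _).2 fun u _ => ?_
    by_cases hu : p.eval u = 0
    · exact Eventually.of_forall fun r h => absurd hu h
    have hpos : 0 < ‖p.eval u‖ / 2 := half_pos (norm_pos_iff.2 hu)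
    have hev : ∀ᶠ w in 𝓝 u, ‖p.eval u‖ / 2 < ‖p.eval w‖ :=
      p.continuous.norm.continuousAt.eventually (lt_mem_nhds (half_lt_self (norm_pos_iff.2 hu)))
    obtain ⟨e, he, h⟩ := Metric.eventually_nhds_iff_ball.1 hev
    filter_upwards [Ioo_mem_nhdsGT (lt_min hpos he)] with r hr _ w hw
    exact (hr.2.trans_le (min_le_left _ _)).le.trans
      (h w (Metric.ball_subset_ball (hr.2.trans_le (min_le_right _ _)).le hw)).le
  obtain ⟨r, h, hr⟩ := (h.and self_mem_nhdsWithin).exists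
  exact ⟨r, hr, h⟩

/-- In a finite set of points, a point of maximal norm is not the mean of several points. -/
theorem card_le_one_of_sum_sub_eq_zero {s : Finset ℂ} {w : ℂ} (hs : ∀ z ∈ s, ‖z‖ ≤ ‖w‖)
    (hsum : ∑ z ∈ s, (w - z) = 0) : s.card ≤ 1 := by
  have h1 : ∑ z ∈ s, inner ℝ w (w - z) = 0 := by rw [← inner_sum, hsum, inner_zero_right]
  have hnn : ∀ z ∈ s, 0 ≤ inner ℝ w (w - z) := by
    intro z hz
    rw [inner_sub_right, real_inner_self_eq_norm_sq, sub_nonneg]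
    calc inner ℝ w z ≤ ‖w‖ * ‖z‖ := real_inner_le_norm w z
      _ ≤ ‖w‖ * ‖w‖ := by gcongr; exact hs z hz
      _ = ‖w‖ ^ 2 := by ring
  have h2 := (Finset.sum_eq_zero_iff_of_nonneg hnn).1 h1
  have h3 : ∀ z ∈ s, z = w := by
    intro z hz
    have h4 := h2 z hz
    rw [inner_sub_right, real_inner_self_eq_norm_sq, sub_eq_zero] at h4
    have h5 := norm_sub_sq_real w z
    have h6 : ‖z‖ ^ 2 ≤ ‖w‖ ^ 2 := by
      gcongr
      exact hs z hz
    have h7 : ‖w - z‖ ^ 2 ≤ 0 := by rw [h5, ← h4]; linarith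
    have h8 : ‖w - z‖ = 0 := by
      have := sq_nonneg ‖w - z‖
      exact pow_eq_zero_iff two_ne_zero |>.1 (le_antisymm h7 this)
    exact (sub_eq_zero.1 (norm_eq_zero.1 h8)).symm
  exact Finset.card_le_one.2 fun a ha b hb => (h3 a ha).trans (h3 b hb).symm

/-- If the correspondence maps the finite set `s` to itself, then every point of `s` has exactly
`deg Q k` preimages in `s`. -/
theorem card_filter_isRoot_eq {k : ℕ} {Q : ℕ → ℂ[X]} {c : ℕ → ℂ} (hT : NonDegenerate k Q)
    (hc : ∀ j ≤ k, c j ≠ 0) (hQ : ¬ ∃ a : ℂ, ∀ j ≤ k, (Q j).eval a = 0) {s : Finset ℂ}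
    [∀ z w, Decidable ((weighted k Q c z).IsRoot w)]
    (hs : ∀ z ∈ s, (s.filter fun w => (weighted k Q c z).IsRoot w).card = (Q k).natDegree) :
    ∀ w ∈ s, (s.filter fun z => (weighted k Q c z).IsRoot w).card = (Q k).natDegree := by
  have hle : ∀ w ∈ s, (s.filter fun z => (weighted k Q c z).IsRoot w).card ≤ (Q k).natDegree := by
    intro w _
    calc _ = ((s.filter fun z => (weighted k Q c z).IsRoot w).image fun z => w - z).card :=
          (Finset.card_image_of_injective _ sub_right_injective).symm
      _ ≤ (cofibre k Q c w).roots.toFinset.card := by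
          refine Finset.card_le_card fun t ht => ?_
          obtain ⟨z, hz, rfl⟩ := Finset.mem_image.1 ht
          rw [Multiset.mem_toFinset, mem_roots (cofibre_ne_zero hc hQ w), IsRoot, eval_cofibre]
          exact (Finset.mem_filter.1 hz).2
      _ ≤ (cofibre k Q c w).roots.card := Multiset.toFinset_card_le _
      _ ≤ (cofibre k Q c w).natDegree := card_roots' _
      _ ≤ _ := natDegree_cofibre_le' hT c w
  -- Counted by sources the relation has d|s| pairs; counted by targets it has at most d for each
  -- point, so equality holds at every target.
  refine (Finset.sum_eq_sum_iff_of_le hle).1 ?_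
  have h1 := Finset.sum_card_bipartiteAbove_eq_sum_card_bipartiteBelow (s := s) (t := s)
    (fun z w => (weighted k Q c z).IsRoot w)
  unfold Finset.bipartiteAbove Finset.bipartiteBelow at h1
  rw [← h1]
  exact Finset.sum_congr rfl hs

/-- In a finite invariant set S every w has d preimages z in S, and the numbers w - z are all the
roots of the cofibre polynomial. Vieta then gives c_{k-d+1} Q_{k-d+1}(w) = -c_{k-d} Q_{k-d}(w) ∑ (w
- z), where Q_{k-d} is a non-zero constant and deg Q_{k-d+1} ≤ 1. If Q_{k-d+1} = 0, every point of S
is the mean of d ≥ 2 points of S, which fails at a point of maximal modulus. Otherwise Q_{k-d+1} is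
bounded away from 0 near some zero of Q_k; S has a point there, and c_{k-d} is too small compared
with c_{k-d+1}. -/
theorem IsContracting.infinite_of_invariant {k : ℕ} {Q : ℕ → ℂ[X]} {c : ℕ → ℂ} {R ρ β q η r : ℝ}
    (h : IsContracting k Q c R ρ β q) (hβ : 0 < β) (hT : NonDegenerate k Q)
    (hsimple : ∀ u : ℂ, (Q k).IsRoot u → (Q k).rootMultiplicity u = 1)
    (hd : 2 ≤ (Q k).natDegree) (hQ : ¬ ∃ a : ℂ, ∀ j ≤ k, (Q j).eval a = 0)
    (hc : SmallWeights k η c) (hη0 : 0 ≤ η) (hρr : ρ ≤ r)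
    (hr : ∀ u ∈ (Q k).roots.toFinset, (Q (k - (Q k).natDegree + 1)).eval u ≠ 0 →
      ∀ w ∈ Metric.ball u r, r ≤ ‖(Q (k - (Q k).natDegree + 1)).eval w‖)
    (hη : η * (‖(Q (k - (Q k).natDegree)).coeff 0‖ * ((Q k).natDegree * (2 * R))) < r)
    {S : Set ℂ} (hSR : S ⊆ Metric.closedBall 0 R) (hne : S.Nonempty)
    (hinv : ∀ z ∈ S, ∀ w, (weighted k Q c z).IsRoot w → w ∈ S) : S.Infinite := by
  classical
  intro hfin
  set d := (Q k).natDegree with hd_def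
  set s := hfin.toFinset with hs_def
  have hmem : ∀ z, z ∈ s ↔ z ∈ S := fun z => hfin.mem_toFinset
  have hnorm : ∀ z ∈ s, ‖z‖ ≤ R := fun z hz => mem_closedBall_zero_iff.1 (hSR ((hmem z).1 hz))
  have hfw : ∀ z ∈ s, (s.filter fun w => (weighted k Q c z).IsRoot w).card = d := by
    intro z hz
    obtain ⟨f, hf, hroots⟩ := h.exists_branches hβ hT.1 (by omega) hsimple (hnorm z hz)
    have hp0 : weighted k Q c z ≠ 0 := by
      intro h0
      have := h.natDegree_eq z
      rw [h0, natDegree_zero] at this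
      omega
    have hinj : Function.Injective f := by
      intro u u' huu
      by_contra hne'
      have h1 := h.ball_disjoint u u' u.isRoot u'.isRoot fun h => hne' (Subtype.ext h)
      have h2 := mem_ball_iff_norm.1 (hf u)
      have h3 := mem_ball_iff_norm.1 (hf u')
      rw [huu] at h2
      have h4 := _root_.norm_sub_le (f u' - (u' : ℂ)) (f u' - (u : ℂ))
      rw [sub_sub_sub_cancel_left] at h4
      linarith
    have : (s.filter fun w => (weighted k Q c z).IsRoot w) = Finset.univ.image f := by
      ext w
      have : (weighted k Q c z).IsRoot w ↔ ∃ u, f u = w := by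
        rw [← mem_roots hp0, hroots, Multiset.mem_map]
        simp only [Finset.mem_val, Finset.mem_univ, true_and]
      simp only [Finset.mem_filter, Finset.mem_image, Finset.mem_univ, true_and, ← this]
      exact ⟨fun h => h.2, fun hw => ⟨(hmem w).2 (hinv z ((hmem z).1 hz) w hw), hw⟩⟩
    rw [this, Finset.card_image_of_injective _ hinj, Finset.card_univ, card_rootIndex hsimple]
  have hbw := card_filter_isRoot_eq hT hc.ne_zero hQ hfw
  have hsum : ∀ w ∈ s, d ≤ k ∧ (Q (k - d)).eval w ≠ 0 ∧ c (k - d + 1) * (Q (k - d + 1)).eval w =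
      -(c (k - d) * (Q (k - d)).eval w) *
        ∑ z ∈ s.filter (fun z => (weighted k Q c z).IsRoot w), (w - z) := by
    intro w hw
    set G := cofibre k Q c w with hG
    set N := s.filter (fun z => (weighted k Q c z).IsRoot w) with hN
    have hG0 : G ≠ 0 := cofibre_ne_zero hc.ne_zero hQ w
    have hle : (N.image fun z => w - z).val ≤ G.roots := by
      rw [Multiset.le_iff_subset (Finset.nodup _)]
      intro t ht
      obtain ⟨z, hz, rfl⟩ := Finset.mem_image.1 ht
      rw [mem_roots hG0, IsRoot, hG, eval_cofibre]
      exact (Finset.mem_filter.1 hz).2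
    have hcard : (N.image fun z => w - z).card = d := by
      rw [Finset.card_image_of_injective _ sub_right_injective, hbw w hw]
    have hdG : G.natDegree ≤ d := natDegree_cofibre_le' hT c w
    have heq : (N.image fun z => w - z).val = G.roots :=
      Multiset.eq_of_le_of_card_le hle ((card_roots' G).trans (hdG.trans hcard.ge))
    have hdG' : G.natDegree = d := by
      refine le_antisymm hdG ?_
      rw [← hcard, Finset.card_def, heq]
      exact card_roots' G
    have hdk : d ≤ k := hdG' ▸ natDegree_cofibre_le k Q c w
    refine ⟨hdk, fun h0 => hG0 ?_, ?_⟩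
    · rw [← leadingCoeff_eq_zero, leadingCoeff, hdG', hG, coeff_cofibre k Q c w hdk, h0, mul_zero]
    have hnext := (IsAlgClosed.splits G).nextCoeff_eq_neg_sum_roots_mul_leadingCoeff
    rw [nextCoeff_of_natDegree_pos (by omega), ← heq, leadingCoeff, hdG', hG,
      coeff_cofibre k Q c w hdk, coeff_cofibre k Q c w (by omega),
      show k - (d - 1) = k - d + 1 by omega] at hnext
    rw [hnext]
    have : (N.image fun z => w - z).val.sum = ∑ z ∈ N, (w - z) := by
      have := Finset.sum_image (s := N) (g := fun z => w - z) (f := fun t : ℂ => t)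
        sub_right_injective.injOn
      rw [← this, Finset.sum, Multiset.map_id']
    rw [this]
  obtain ⟨z₀, hz₀⟩ := hne
  have hdk : d ≤ k := (hsum z₀ ((hmem z₀).2 hz₀)).1
  have hlead : ∀ w ∈ s, (Q (k - d)).eval w = (Q (k - d)).coeff 0 := by
    intro w hw
    have h0 : Q (k - d) ≠ 0 := fun h0 => (hsum w hw).2.1 (by rw [h0, eval_zero])
    have := hT.natDegree_add_le (Nat.sub_le k d) h0
    have h1 : (Q (k - d)).natDegree = 0 := by omega
    rw [eq_C_of_natDegree_eq_zero h1, eval_C, coeff_C_zero]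
  by_cases hQ1 : Q (k - d + 1) = 0
  · obtain ⟨w, hw, hmax⟩ := s.exists_max_image (fun z => ‖z‖) ⟨z₀, (hmem z₀).2 hz₀⟩
    obtain ⟨-, h2, h1⟩ := hsum w hw
    rw [hQ1, eval_zero, mul_zero, eq_comm, neg_mul, neg_eq_zero, mul_eq_zero] at h1
    have h4 := h1.resolve_left (mul_ne_zero (hc.ne_zero _ (Nat.sub_le _ _)) h2)
    have h5 := card_le_one_of_sum_sub_eq_zero
      (fun z hz => hmax z (Finset.mem_filter.1 hz).1) h4
    rw [hbw w hw] at h5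
    omega
  · have hdeg1 : (Q (k - d + 1)).natDegree ≤ 1 := by
      have := hT.natDegree_add_le (j := k - d + 1) (by omega) hQ1
      omega
    -- A non-zero polynomial of degree at most 1 cannot vanish at all of the d ≥ 2 zeros of Q_k.
    obtain ⟨u, hu, huQ⟩ : ∃ u ∈ (Q k).roots.toFinset, (Q (k - d + 1)).eval u ≠ 0 := by
      by_contra! hall
      have h1 : (Q k).roots.toFinset.card ≤ (Q (k - d + 1)).roots.toFinset.card := by
        refine Finset.card_le_card fun u hu => ?_
        rw [Multiset.mem_toFinset, mem_roots hQ1]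
        exact hall u hu
      have h2 := (Multiset.toFinset_card_le (Q (k - d + 1)).roots).trans (card_roots' _)
      have h3 := card_rootIndex hsimple
      rw [Fintype.card_coe] at h3
      omega
    obtain ⟨f, hf, hroots⟩ := h.exists_branches hβ hT.1 (by omega) hsimple
      (hnorm z₀ ((hmem z₀).2 hz₀))
    set w := f ⟨u, hu⟩ with hw_def
    have hwroot : (weighted k Q c z₀).IsRoot w := by
      refine isRoot_of_mem_roots ?_
      rw [hroots]
      exact Multiset.mem_map_of_mem _ (Finset.mem_univ_val _)
    have hws : w ∈ s := (hmem w).2 (hinv z₀ hz₀ w hwroot)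
    have hlow : r ≤ ‖(Q (k - d + 1)).eval w‖ :=
      hr u hu huQ w (Metric.ball_subset_ball hρr (hf ⟨u, hu⟩))
    have hc1 : 0 < ‖c (k - d + 1)‖ := norm_pos_iff.2 (hc.ne_zero _ (by omega))
    have hR : 0 ≤ R := (norm_nonneg _).trans (hnorm w hws)
    have hup : ‖c (k - d + 1)‖ * ‖(Q (k - d + 1)).eval w‖ ≤
        ‖c (k - d + 1)‖ * (η * (‖(Q (k - d)).coeff 0‖ * (d * (2 * R)))) := by
      rw [← norm_mul]
      rw [(hsum w hws).2.2, norm_mul, norm_neg, norm_mul, hlead w hws]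
      have h2 : ‖∑ z ∈ s.filter (fun z => (weighted k Q c z).IsRoot w), (w - z)‖ ≤
          d * (2 * R) := by
        refine (norm_sum_le_of_le _ (f := fun z => w - z) (n := fun _ => 2 * R)
          fun z hz => ?_).trans ?_
        · have h3 := hnorm z (Finset.mem_filter.1 hz).1
          have h4 := hnorm w hws
          linarith [_root_.norm_sub_le w z]
        · rw [Finset.sum_const, hbw w hws, nsmul_eq_mul]
      have h3 := hc.le (k - d) (by omega)
      calc _ ≤ (η * ‖c (k - d + 1)‖) * ‖(Q (k - d)).coeff 0‖ * (d * (2 * R)) := by gcongr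
        _ = _ := by ring
    have := le_of_mul_le_mul_left hup hc1
    linarith

end HolCorr

/-! ### Correspondences with contracting branches over a disc. -/

namespace HolCorr

/-- Over the disc of radius `R` the correspondence is given by the single-valued branches `f i`,
which are contractions, and the images of points outside of this disc are half as large. -/
structure IsContractive (P : ℂ[X][Y]) {ι : Type*} [Fintype ι] (f : ι → ℂ → ℂ) (R : ℝ)
    (q : NNReal) : Prop where
  pos : 0 < R
  natDegree_eq : P.natDegree = Fintype.card ι
  natDegree_map : ∀ a, (P.map (evalRingHom a)).natDegree = Fintype.card ι
  norm_lt : ∀ z w, P.evalEval z w = 0 → ‖w‖ < max (‖z‖ / 2) R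
  roots_eq : ∀ z, ‖z‖ ≤ R → (P.map (evalRingHom z)).roots = Finset.univ.val.map fun i => f i z
  lipschitz : ∀ i, LipschitzOnWith q (f i) (Metric.closedBall 0 R)
  differentiable : ∀ i, DifferentiableOn ℂ (f i) (Metric.ball 0 R)
  lt_one : q < 1

theorem continuous_evalEval (P : ℂ[X][Y]) : Continuous fun p : ℂ × ℂ => P.evalEval p.1 p.2 := by
  have : (fun p : ℂ × ℂ => P.evalEval p.1 p.2) = fun p =>
      ∑ i ∈ Finset.range (P.natDegree + 1), (P.coeff i).eval p.1 * p.2 ^ i := by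
    ext p
    simp [evalEval, eval_eq_sum_range (p := P), eval_finsetSum]
  rw [this]
  refine continuous_finsetSum _ fun i _ => ?_
  exact ((P.coeff i).continuous.comp continuous_fst).mul (continuous_snd.pow i)

/-- The zeros of the `m`-fold iterate of the correspondence over `a`. -/
def iterRoots (P : ℂ[X][Y]) : ℕ → ℂ → Multiset ℂ
  | 0, a => {a}
  | m + 1, a => (iterRoots P m a).bind fun z => (P.map (evalRingHom z)).roots

theorem iterRoots_add (P : ℂ[X][Y]) (m l : ℕ) (a : ℂ) :
    iterRoots P (m + l) a = (iterRoots P m a).bind (iterRoots P l) := by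
  induction l with
  | zero =>
    change iterRoots P m a = (iterRoots P m a).bind fun z => {z}
    rw [Multiset.bind_singleton, Multiset.map_id']
  | succ l ih =>
    rw [← add_assoc]
    simp only [iterRoots, ih, Multiset.bind_assoc]

namespace IsContractive

variable {P : ℂ[X][Y]} {ι : Type*} [Fintype ι] {f : ι → ℂ → ℂ} {R : ℝ} {q : NNReal}

/-- Taking the closure adds nothing over finite z: the bound on zeros keeps ∞ away, and the affine
curve is closed in ℂ². -/
theorem image_coe (h : IsContractive P f R q) (z : ℂ) :
    image P (z : OnePoint ℂ) = (fun w : ℂ => (w : OnePoint ℂ)) '' {w | P.evalEval z w = 0} := by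
  ext w
  induction w using OnePoint.rec with
  | infty =>
    simp only [Set.mem_image, OnePoint.coe_ne_infty, and_false, exists_false, iff_false]
    intro hmem
    let U : Set (OnePoint ℂ) := (fun w : ℂ => (w : OnePoint ℂ)) '' Metric.ball 0 (‖z‖ + 1)
    let K : Set (OnePoint ℂ) := (fun w : ℂ => (w : OnePoint ℂ)) ''
      Metric.closedBall 0 (max ((‖z‖ + 1) / 2) R)
    have hU : IsOpen U := OnePoint.isOpen_image_coe.2 Metric.isOpen_ball
    have hK : IsClosed K := OnePoint.isClosed_image_coe.2
      ⟨Metric.isClosed_closedBall, isCompact_closedBall _ _⟩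
    obtain ⟨_, ⟨hp1, hp2⟩, z', w', rfl, h0⟩ := mem_closure_iff.1 hmem (U ×ˢ Kᶜ)
      (hU.prod hK.isOpen_compl)
      ⟨⟨z, by simp, rfl⟩, fun ⟨w, _, hw⟩ => OnePoint.coe_ne_infty w hw⟩
    obtain ⟨z'', hz'', heq⟩ := hp1
    obtain rfl : z'' = z' := OnePoint.coe_injective heq
    refine hp2 ⟨w', ?_, rfl⟩
    rw [mem_closedBall_zero_iff]
    refine (h.norm_lt _ _ h0).le.trans (max_le_max ?_ le_rfl)
    have := mem_ball_zero_iff.1 hz''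
    linarith
  | coe w =>
    let e : ℂ × ℂ → OnePoint ℂ × OnePoint ℂ :=
      Prod.map (fun w : ℂ => (w : OnePoint ℂ)) (fun w : ℂ => (w : OnePoint ℂ))
    have he : IsOpenEmbedding e :=
      OnePoint.isOpenEmbedding_coe.prodMap OnePoint.isOpenEmbedding_coe
    let Z : Set (ℂ × ℂ) := {p | P.evalEval p.1 p.2 = 0}
    have hZ : IsClosed Z := isClosed_eq (continuous_evalEval P) continuous_const
    have hgraph : graph P = closure (e '' Z) := by
      rw [graph]
      congr 1
      ext p
      constructor
      · rintro ⟨z, w, rfl, h0⟩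
        exact ⟨(z, w), h0, rfl⟩
      · rintro ⟨⟨z, w⟩, h0, rfl⟩
        exact ⟨z, w, rfl, h0⟩
    have h1 : ((z : OnePoint ℂ), (w : OnePoint ℂ)) ∈ graph P ↔ (z, w) ∈ closure Z := by
      rw [he.isInducing.closure_eq_preimage_closure_image, hgraph]
      rfl
    rw [hZ.closure_eq] at h1
    rw [OnePoint.coe_injective.mem_set_image]
    exact h1

theorem map_ne_zero [Nonempty ι] (h : IsContractive P f R q) (z : ℂ) :
    P.map (evalRingHom z) ≠ 0 := by
  intro h0
  have := h.natDegree_map z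
  rw [h0, natDegree_zero] at this
  exact Fintype.card_ne_zero this.symm

theorem mem_roots_iff [Nonempty ι] (h : IsContractive P f R q) (z w : ℂ) :
    w ∈ (P.map (evalRingHom z)).roots ↔ P.evalEval z w = 0 := by
  rw [mem_roots (h.map_ne_zero z), IsRoot, eval_map, eval₂_evalRingHom]

theorem evalEval_eq_zero_iff [Nonempty ι] (h : IsContractive P f R q) {z : ℂ} (hz : ‖z‖ ≤ R)
    (w : ℂ) : P.evalEval z w = 0 ↔ ∃ i, f i z = w := by
  rw [← h.mem_roots_iff, h.roots_eq z hz]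
  simp

theorem norm_branch_lt [Nonempty ι] (h : IsContractive P f R q) {z : ℂ} (hz : ‖z‖ ≤ R) (i : ι) :
    ‖f i z‖ < R := by
  have := h.norm_lt z (f i z) ((h.evalEval_eq_zero_iff hz _).2 ⟨i, rfl⟩)
  rwa [max_eq_right (by linarith [norm_nonneg z])] at this

theorem card_roots_map (h : IsContractive P f R q) (a : ℂ) :
    (P.map (evalRingHom a)).roots.card = Fintype.card ι := by
  rw [← (IsAlgClosed.splits _).natDegree_eq_card_roots, h.natDegree_map]

/-- P(a, ·) has full degree for every a ∈ ℂ, so ∞ does not occur in the fibre. -/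
theorem fibre_coe (h : IsContractive P f R q) (a : ℂ) :
    fibre P (a : OnePoint ℂ) =
      (P.map (evalRingHom a)).roots.map fun w : ℂ => (w : OnePoint ℂ) := by
  have : P.natDegree - (slice P (a : OnePoint ℂ)).natDegree = 0 := by
    change P.natDegree - (P.map (evalRingHom a)).natDegree = 0
    rw [h.natDegree_eq, h.natDegree_map, Nat.sub_self]
  rw [fibre, this, Multiset.replicate_zero, add_zero]
  rfl

theorem iterFibre_coe (h : IsContractive P f R q) (m : ℕ) (a : ℂ) :
    iterFibre P m (a : OnePoint ℂ) = (iterRoots P m a).map fun w : ℂ => (w : OnePoint ℂ) := by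
  induction m with
  | zero => simp [iterFibre, iterRoots]
  | succ m ih =>
    rw [iterFibre, iterRoots, ih, Multiset.bind_map, Multiset.map_bind]
    exact Multiset.bind_congr fun z _ => h.fibre_coe z

theorem card_iterRoots (h : IsContractive P f R q) (m : ℕ) (a : ℂ) :
    (iterRoots P m a).card = Fintype.card ι ^ m := by
  induction m with
  | zero => simp [iterRoots]
  | succ m ih =>
    rw [iterRoots, Multiset.card_bind]
    simp [h.card_roots_map, ih, pow_succ]

theorem norm_le_of_mem_iterRoots [Nonempty ι] (h : IsContractive P f R q) (m : ℕ) (a : ℂ) :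
    ∀ w ∈ iterRoots P m a, ‖w‖ ≤ max (‖a‖ / 2 ^ m) R := by
  induction m with
  | zero => simp [iterRoots]
  | succ m ih =>
    intro w hw
    obtain ⟨z, hz, hw⟩ := Multiset.mem_bind.1 hw
    refine (h.norm_lt z w ((h.mem_roots_iff z w).1 hw)).le.trans (max_le ?_ (le_max_right _ _))
    have h1 := ih z hz
    rcases le_max_iff.1 h1 with h2 | h2
    · refine le_max_of_le_left ?_
      rw [pow_succ, ← div_div]
      linarith
    · refine le_max_of_le_right ?_
      linarith [h.pos]

theorem exists_forall_mem_iterRoots [Nonempty ι] (h : IsContractive P f R q) (a : ℂ) :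
    ∃ m, ∀ w ∈ iterRoots P m a, ‖w‖ ≤ R := by
  obtain ⟨m, hm⟩ := pow_unbounded_of_one_lt (‖a‖ / R) (one_lt_two (α := ℝ))
  refine ⟨m, fun w hw => (h.norm_le_of_mem_iterRoots m a w hw).trans (max_le ?_ le_rfl)⟩
  rw [div_lt_iff₀ h.pos] at hm
  rw [div_le_iff₀ (by positivity)]
  linarith

theorem mem_of_mem_iterRoots [Nonempty ι] (h : IsContractive P f R q) {S : Set ℂ}
    (hS : ∀ z ∈ S, ∀ w, P.evalEval z w = 0 → w ∈ S) {a : ℂ} (ha : a ∈ S) (m : ℕ) :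
    ∀ w ∈ iterRoots P m a, w ∈ S := by
  induction m with
  | zero => simpa [iterRoots] using ha
  | succ m ih =>
    intro w hw
    obtain ⟨z, hz, hw⟩ := Multiset.mem_bind.1 hw
    exact hS z (ih z hz) w ((h.mem_roots_iff z w).1 hw)

/-- A non-empty set which is invariant under the correspondence meets the disc of radius `R`. -/
theorem exists_mem_norm_le [Nonempty ι] (h : IsContractive P f R q) {S : Set ℂ}
    (hS : ∀ z ∈ S, ∀ w, P.evalEval z w = 0 → w ∈ S) (hne : S.Nonempty) : ∃ w ∈ S, ‖w‖ ≤ R := by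
  obtain ⟨a, ha⟩ := hne
  obtain ⟨m, hm⟩ := h.exists_forall_mem_iterRoots a
  have hcard : 0 < (iterRoots P m a).card := by
    rw [h.card_iterRoots]
    exact pow_pos Fintype.card_pos m
  obtain ⟨w, hw⟩ := Multiset.card_pos_iff_exists_mem.1 hcard
  exact ⟨w, h.mem_of_mem_iterRoots hS ha m w hw, hm w hw⟩

theorem wordMap_mem_iterImage [Nonempty ι] (h : IsContractive P f R q) (l : List ι) {x : ℂ}
    (hx : ‖x‖ < R) : ‖IFS.wordMap f l x‖ < R ∧
      ((IFS.wordMap f l x : ℂ) : OnePoint ℂ) ∈ iterImage P l.length (x : OnePoint ℂ) := by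
  induction l with
  | nil => exact ⟨hx, rfl⟩
  | cons i l ih =>
    refine ⟨h.norm_branch_lt ih.1.le i, _, ih.2, ?_⟩
    rw [h.image_coe]
    exact ⟨_, (h.evalEval_eq_zero_iff ih.1.le _).2 ⟨i, rfl⟩, rfl⟩

theorem differentiableOn_wordMap [Nonempty ι] (h : IsContractive P f R q) (l : List ι) :
    DifferentiableOn ℂ (IFS.wordMap f l) (Metric.ball 0 R) := by
  induction l with
  | nil => exact differentiableOn_id
  | cons i l ih =>
    exact (h.differentiable i).comp ih fun x hx =>
      mem_ball_zero_iff.2 (h.wordMap_mem_iterImage l (mem_ball_zero_iff.1 hx)).1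

theorem mapsTo_closedBall [Nonempty ι] (h : IsContractive P f R q) (i : ι) :
    Set.MapsTo (f i) (Metric.closedBall 0 R) (Metric.closedBall 0 R) := fun _ hz =>
  mem_closedBall_zero_iff.2 (h.norm_branch_lt (mem_closedBall_zero_iff.1 hz) i).le

theorem lipschitzOnWith_wordMap [Nonempty ι] (h : IsContractive P f R q) (l : List ι) :
    LipschitzOnWith (q ^ l.length) (IFS.wordMap f l) (Metric.closedBall 0 R) :=
  IFS.lipschitzOnWith_wordMap h.lipschitz h.mapsTo_closedBall l

theorem isAttractingPeriodic_of_wordMap_eq [Nonempty ι] (h : IsContractive P f R q) {l : List ι}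
    (hl : l ≠ []) {x : ℂ} (hx : ‖x‖ < R) (hfix : IFS.wordMap f l x = x) :
    IsAttractingPeriodic P x := by
  have hball : Metric.ball (0 : ℂ) R ∈ 𝓝 x :=
    Metric.isOpen_ball.mem_nhds (mem_ball_zero_iff.2 hx)
  have hlen : 1 ≤ l.length := List.length_pos_iff.2 hl
  refine ⟨l.length, hlen, IFS.wordMap f l,
    (h.differentiableOn_wordMap l).analyticAt hball, ?_, hfix, ?_⟩
  · filter_upwards [hball] with y hy
    exact (h.wordMap_mem_iterImage l (mem_ball_zero_iff.1 hy)).2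
  · refine lt_of_le_of_lt (norm_deriv_le_of_lipschitzOn (mem_of_superset hball
      Metric.ball_subset_closedBall) (h.lipschitzOnWith_wordMap l)) ?_
    have : q ^ l.length < 1 := pow_lt_one₀ q.2 h.lt_one (by omega)
    exact_mod_cast this

/-- Every word in the branches has a fixed point in the disc. -/
theorem exists_wordMap_eq_self [Nonempty ι] (h : IsContractive P f R q) {l : List ι} (hl : l ≠ []) :
    ∃ x, ‖x‖ < R ∧ IFS.wordMap f l x = x := by
  have hmaps : Set.MapsTo (IFS.wordMap f l) (Metric.closedBall 0 R) (Metric.closedBall 0 R) :=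
    IFS.mapsTo_wordMap h.mapsTo_closedBall l
  have hlen : 1 ≤ l.length := List.length_pos_iff.2 hl
  have hc : ContractingWith (q ^ l.length) (hmaps.restrict _ _ _) :=
    ⟨pow_lt_one₀ q.2 h.lt_one (by omega), (h.lipschitzOnWith_wordMap l).mapsToRestrict hmaps⟩
  obtain ⟨y, hy, hfix, -⟩ := hc.exists_fixedPoint' (Metric.isClosed_closedBall.isComplete) hmaps
    (x := 0) (by simp [h.pos.le]) (edist_ne_top _ _)
  refine ⟨y, ?_, hfix⟩
  cases l with
  | nil => exact absurd rfl hl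
  | cons i l =>
    have : f i (IFS.wordMap f l y) = y := hfix
    rw [← this]
    exact h.norm_branch_lt
      (mem_closedBall_zero_iff.1 (IFS.mapsTo_wordMap h.mapsTo_closedBall l hy)) i

/-- The points of a set covered by its images under the branches are limits of attracting periodic
points. -/
theorem exists_seq_isAttractingPeriodic [Nonempty ι] (h : IsContractive P f R q) {S : Set ℂ}
    (hSR : S ⊆ Metric.closedBall 0 R) (hsurj : ∀ x ∈ S, ∃ i, ∃ y ∈ S, f i y = x) {w : ℂ}
    (hw : w ∈ S) : ∃ v : ℕ → ℂ, (∀ i, IsAttractingPeriodic P (v i)) ∧ Tendsto v atTop (𝓝 w) := by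
  -- The exponent m + 1 keeps the word non-empty. Its fixed point and w are both images under the
  -- word of points of the disc, whose diameter is 2R.
  have hex : ∀ m : ℕ, ∃ x, IsAttractingPeriodic P x ∧ dist x w ≤ (q : ℝ) ^ (m + 1) * (2 * R) := by
    intro m
    obtain ⟨l, hl, y, hy, hyw⟩ := IFS.exists_wordMap_eq hsurj (m + 1) w hw
    have hl0 : l ≠ [] := by rintro rfl; simp at hl
    obtain ⟨x, hx, hfix⟩ := h.exists_wordMap_eq_self hl0
    refine ⟨x, h.isAttractingPeriodic_of_wordMap_eq hl0 hx hfix, ?_⟩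
    have hxR : x ∈ Metric.closedBall (0 : ℂ) R := mem_closedBall_zero_iff.2 hx.le
    have h1 := (h.lipschitzOnWith_wordMap l).dist_le_mul x hxR y (hSR hy)
    rw [hfix, hyw, hl] at h1
    refine h1.trans ?_
    push_cast
    gcongr
    refine (dist_triangle_right x y 0).trans ?_
    have h2 := Metric.mem_closedBall.1 hxR
    have h3 := Metric.mem_closedBall.1 (hSR hy)
    linarith
  choose v hv1 hv2 using hex
  refine ⟨v, hv1, ?_⟩
  rw [tendsto_iff_dist_tendsto_zero]
  refine squeeze_zero (fun _ => dist_nonneg) hv2 ?_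
  have hlim : Tendsto (fun m : ℕ => (q : ℝ) ^ m * (2 * R)) atTop (𝓝 (0 * (2 * R))) :=
    (tendsto_pow_atTop_nhds_zero_of_lt_one q.2 (by exact_mod_cast h.lt_one)).mul_const _
  rw [zero_mul] at hlim
  exact (tendsto_add_atTop_iff_nat 1).2 hlim

end IsContractive

theorem integral_sum_dirac (s : Multiset (OnePoint ℂ)) (φ : C(OnePoint ℂ, ℝ)) :
    Integrable φ (s.map Measure.dirac).sum ∧
      ∫ x, φ x ∂(s.map Measure.dirac).sum = (s.map φ).sum := by
  induction s using Multiset.induction with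
  | empty => simp
  | cons a s ih =>
    have ha : Integrable φ (Measure.dirac a) := integrable_dirac (by simp)
    rw [Multiset.map_cons, Multiset.sum_cons]
    refine ⟨ha.add_measure ih.1, ?_⟩
    rw [integral_add_measure ha ih.1, ih.2, integral_dirac, Multiset.map_cons, Multiset.sum_cons]

end HolCorr

/-! ### The equilibrium measure on the sphere. -/

namespace HolCorr

namespace IsContractive

variable {P : ℂ[X][Y]} {ι : Type*} [Fintype ι] [Nonempty ι] {f : ι → ℂ → ℂ} {R : ℝ} {q : NNReal}

/-- The branches as continuous self-maps of the closed disc. -/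
def branch (h : IsContractive P f R q) (i : ι) :
    C(Metric.closedBall (0 : ℂ) R, Metric.closedBall (0 : ℂ) R) :=
  ⟨(h.mapsTo_closedBall i).restrict _ _ _,
    (h.lipschitz i).continuousOn.mapsToRestrict (h.mapsTo_closedBall i)⟩

theorem lipschitzWith_branch (h : IsContractive P f R q) (i : ι) : LipschitzWith q (h.branch i) :=
  (h.lipschitz i).mapsToRestrict (h.mapsTo_closedBall i)

/-- Translates sums over images with multiplicity into iterates of the averaging operator. The
induction varies φ, since its step passes to d times the average of φ. -/
theorem sum_iterRoots (h : IsContractive P f R q) (m : ℕ) :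
    ∀ (φ : C(Metric.closedBall (0 : ℂ) R, ℝ)) (g : ℂ → ℝ),
      (∀ x : Metric.closedBall (0 : ℂ) R, g x = φ x) → ∀ x : Metric.closedBall (0 : ℂ) R,
        ((iterRoots P m x).map g).sum =
          (Fintype.card ι : ℝ) ^ m * (IFS.transfer h.branch ^ m) φ x := by
  induction m with
  | zero => intro φ g hg x; simp [iterRoots, hg]
  | succ m ih =>
    intro φ g hg x
    have hcard : (Fintype.card ι : ℝ) ≠ 0 := by exact_mod_cast Fintype.card_ne_zero
    have h1 : ∀ y : Metric.closedBall (0 : ℂ) R,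
        (((P.map (evalRingHom (y : ℂ))).roots).map g).sum =
          ((Fintype.card ι : ℝ) • IFS.transfer h.branch φ) y := by
      intro y
      rw [h.roots_eq y (mem_closedBall_zero_iff.1 y.2), Multiset.map_map,
        ContinuousMap.smul_apply, IFS.transfer_apply, smul_eq_mul, mul_inv_cancel_left₀ hcard]
      exact Finset.sum_congr rfl fun i _ => hg (h.branch i y)
    rw [iterRoots, Multiset.map_bind, Multiset.sum_bind, ih _ _ h1, map_smul,
      ContinuousMap.smul_apply, smul_eq_mul, IFS.transfer_pow_succ_apply]
    ring

theorem exists_measure (h : IsContractive P f R q) :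
    ∃ (μ : Measure (OnePoint ℂ)) (S : Set ℂ),
      IsProbabilityMeasure μ ∧ IsPushforward P μ ((Fintype.card ι : ENNReal) • μ) ∧
      (∀ (a : ℂ) (φ : C(OnePoint ℂ, ℝ)),
          Tendsto (fun m : ℕ => (1 / (Fintype.card ι : ℝ) ^ m) *
              ∫ x, φ x ∂(pushDirac P m (a : OnePoint ℂ)))
            atTop (𝓝 (∫ x, φ x ∂μ))) ∧
      IsCompact S ∧ S ⊆ Metric.closedBall 0 R ∧ S.Nonempty ∧ (∀ i, Set.MapsTo (f i) S S) ∧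
      (∀ x ∈ S, ∃ i, ∃ y ∈ S, f i y = x) ∧
      (fun u : ℂ => (u : OnePoint ℂ)) '' S = μ.support ∧
      ∀ S' : Set ℂ, IsClosed S' → (∃ a ∈ S', ‖a‖ ≤ R) →
        (∀ z ∈ S', ‖z‖ ≤ R → ∀ i, f i z ∈ S') → S ⊆ S' := by
  have : Nonempty (Metric.closedBall (0 : ℂ) R) := ⟨⟨0, by simp [h.pos.le]⟩⟩
  have : CompactSpace (Metric.closedBall (0 : ℂ) R) :=
    isCompact_iff_compactSpace.1 (isCompact_closedBall 0 R)
  have hcard : (Fintype.card ι : ℝ) ≠ 0 := by exact_mod_cast Fintype.card_ne_zero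
  obtain ⟨ν, hν, hlim⟩ := IFS.exists_measure_tendsto_transfer_pow h.lt_one h.lipschitzWith_branch
  let j : Metric.closedBall (0 : ℂ) R → OnePoint ℂ := fun x => ((x : ℂ) : OnePoint ℂ)
  have hjc : Continuous j := OnePoint.continuous_coe.comp continuous_subtype_val
  have hj : IsClosedEmbedding j :=
    hjc.isClosedEmbedding (OnePoint.coe_injective.comp Subtype.val_injective)
  have hjm : MeasurableEmbedding j := hj.measurableEmbedding
  have hint : ∀ φ : OnePoint ℂ → ℝ, ∫ x, φ x ∂(ν.map j) = ∫ x, φ (j x) ∂ν := fun φ =>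
    hjm.integral_map φ
  have hfib : ∀ (φ : C(OnePoint ℂ, ℝ)) (x : Metric.closedBall (0 : ℂ) R),
      ((fibre P (j x)).map φ).sum =
        Fintype.card ι * IFS.transfer h.branch (φ.comp ⟨j, hjc⟩) x := by
    intro φ x
    rw [IFS.transfer_apply, mul_inv_cancel_left₀ hcard]
    change ((fibre P ((x : ℂ) : OnePoint ℂ)).map φ).sum = _
    rw [h.fibre_coe, h.roots_eq x (mem_closedBall_zero_iff.1 x.2), Multiset.map_map,
      Multiset.map_map]
    rfl
  have hcont : ∀ ψ : C(Metric.closedBall (0 : ℂ) R, ℝ), Integrable ψ ν := fun ψ =>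
    ψ.continuous.integrable_of_hasCompactSupport (HasCompactSupport.of_compactSpace _)
  refine ⟨ν.map j, Subtype.val '' ν.support, Measure.isProbabilityMeasure_map hjc.aemeasurable,
    fun φ => ⟨?_, ?_⟩, fun a φ => ?_, ?_, ?_, ?_, ?_, ?_, ?_, ?_⟩
  · rw [hjm.integrable_map_iff]
    refine ((hcont (IFS.transfer h.branch (φ.comp ⟨j, hjc⟩))).const_mul (Fintype.card ι : ℝ)).congr
      (Eventually.of_forall fun x => ?_)
    exact (hfib φ x).symm
  · rw [integral_smul_measure, hint, hint]
    simp_rw [hfib]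
    rw [integral_const_mul, IFS.integral_transfer hlim]
    simp
  -- After m₀ steps all d^m₀ images of a are in the disc, and the convergence there is applied to
  -- each of them.
  · obtain ⟨m₀, hm₀⟩ := h.exists_forall_mem_iterRoots a
    rw [hint, ← tendsto_add_atTop_iff_nat m₀]
    let ψ : C(Metric.closedBall (0 : ℂ) R, ℝ) := φ.comp ⟨j, hjc⟩
    -- The value outside the disc is irrelevant: only the images of a after m₀ steps are inserted.
    let proj : ℂ → Metric.closedBall (0 : ℂ) R := fun w =>
      if hw : ‖w‖ ≤ R then ⟨w, mem_closedBall_zero_iff.2 hw⟩ else Classical.arbitrary _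
    have hproj : ∀ w, ‖w‖ ≤ R → (proj w : ℂ) = w := fun w hw => by simp [proj, hw]
    have hval : ∀ m, ∫ x, φ x ∂(pushDirac P (m + m₀) (a : OnePoint ℂ)) =
        (Fintype.card ι : ℝ) ^ m *
          ((iterRoots P m₀ a).map fun w => (IFS.transfer h.branch ^ m) ψ (proj w)).sum := by
      intro m
      rw [pushDirac, (integral_sum_dirac _ φ).2, h.iterFibre_coe, Multiset.map_map, add_comm m,
        iterRoots_add, Multiset.map_bind, Multiset.sum_bind, ← Multiset.sum_map_mul_left]
      congr 1
      refine Multiset.map_congr rfl fun w hw => ?_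
      have := h.sum_iterRoots m ψ (fun w : ℂ => φ (w : OnePoint ℂ)) (fun x => rfl) (proj w)
      rw [hproj w (hm₀ w hw)] at this
      exact this
    have hlim' : Tendsto (fun m : ℕ => (1 / (Fintype.card ι : ℝ) ^ m₀) *
        ((iterRoots P m₀ a).map fun w => (IFS.transfer h.branch ^ m) ψ (proj w)).sum) atTop
        (𝓝 ((1 / (Fintype.card ι : ℝ) ^ m₀) *
          ((iterRoots P m₀ a).map fun _ => ∫ x, ψ x ∂ν).sum)) :=
      (tendsto_multiset_sum _ fun w _ => hlim ψ (proj w)).const_mul _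
    rw [Multiset.map_const', Multiset.sum_replicate, h.card_iterRoots, nsmul_eq_mul,
      Nat.cast_pow, ← mul_assoc, one_div_mul_cancel (pow_ne_zero _ hcard), one_mul] at hlim'
    refine hlim'.congr fun m => ?_
    rw [hval, ← mul_assoc, pow_add]
    congr 1
    field_simp
  · exact Measure.isClosed_support.isCompact.image continuous_subtype_val
  · rintro _ ⟨x, -, rfl⟩
    exact x.2
  · exact (Measure.nonempty_support (IsProbabilityMeasure.ne_zero ν)).image _
  · rintro i _ ⟨x, hx, rfl⟩
    exact ⟨h.branch i x, IFS.mapsTo_support hlim i hx, rfl⟩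
  · rintro _ ⟨x, hx, rfl⟩
    obtain ⟨i, y, hy, rfl⟩ := IFS.exists_mem_support_eq hlim hx
    exact ⟨i, y, ⟨y, hy, rfl⟩, rfl⟩
  · have himage : (fun u : ℂ => (u : OnePoint ℂ)) '' (Subtype.val '' ν.support) =
        j '' ν.support := Set.image_image _ _ _
    rw [himage]
    apply Set.Subset.antisymm
    · rintro _ ⟨x, hx, rfl⟩
      rw [Measure.mem_support_iff_forall]
      intro U hU
      rw [hjm.map_apply]
      exact (Measure.mem_support_iff_forall x).1 hx _ (hjc.continuousAt hU)
    · refine Measure.support_subset_of_isClosed (hj.isClosedMap _ Measure.isClosed_support) ?_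
      rw [mem_ae_iff, hjm.map_apply, Set.preimage_compl, Set.preimage_image_eq _ hj.injective]
      exact Measure.measure_compl_support
  · rintro S' hS' ⟨a, ha, haR⟩ hinv
    have hsub := IFS.support_subset_of_mapsTo hlim (K := Subtype.val ⁻¹' S')
      (hS'.preimage continuous_subtype_val) ⟨⟨a, mem_closedBall_zero_iff.2 haR⟩, ha⟩
      (fun i x hx => hinv x hx (mem_closedBall_zero_iff.1 x.2) i)
    rintro _ ⟨x, hx, rfl⟩
    exact hsub hx

end IsContractive

/-! ### The correspondence of a differential operator -/

/-- The coefficients of the correspondence relative to the coefficient of `Q k`. -/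
def weight (k n j : ℕ) : ℂ := (n.descFactorial j : ℂ) / (n.descFactorial k : ℂ)

/-- Consecutive falling factorials have ratio n - j, which is at least n - k + 1 for j < k. -/
theorem smallWeights_weight {k n : ℕ} (hn : k ≤ n) :
    SmallWeights k (1 / ((n - k : ℕ) + 1 : ℝ)) (weight k n) := by
  have hne : ∀ j ≤ k, (n.descFactorial j : ℂ) ≠ 0 := fun j hj => by
    exact_mod_cast (Nat.descFactorial_pos.2 (hj.trans hn)).ne'
  refine ⟨div_self (hne k le_rfl), fun j hj => div_ne_zero (hne j hj) (hne k le_rfl),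
    fun j hj => ?_⟩
  have h1 : weight k n (j + 1) = ((n - j : ℕ) : ℂ) * weight k n j := by
    rw [weight, weight, Nat.descFactorial_succ]
    push_cast
    ring
  rw [h1, norm_mul, Complex.norm_natCast, ← mul_assoc]
  refine le_mul_of_one_le_left (norm_nonneg _) ?_
  rw [one_div, le_inv_mul_iff₀ (by positivity), mul_one]
  have : n - k + 1 ≤ n - j := by omega
  exact_mod_cast this

theorem map_corrPoly {k n : ℕ} (Q : ℕ → ℂ[X]) (hn : k ≤ n) (a : ℂ) :
    (corrPoly k Q n).map (evalRingHom a) =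
      C (n.descFactorial k : ℂ) * weighted k Q (weight k n) a := by
  have hne : (n.descFactorial k : ℂ) ≠ 0 := by exact_mod_cast (Nat.descFactorial_pos.2 hn).ne'
  rw [corrPoly_eq k Q n hn, Polynomial.map_sum, weighted, Finset.mul_sum]
  refine Finset.sum_congr rfl fun j _ => ?_
  have h1 : ((Q j).map C).map (evalRingHom a) = Q j := by
    have h2 : (evalRingHom a).comp C = RingHom.id ℂ := RingHom.ext fun z => by simp
    rw [Polynomial.map_map, h2, Polynomial.map_id]
  rw [← mul_assoc, ← C_mul, weight, mul_div_cancel₀ _ hne]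
  simp [Polynomial.map_mul, h1]

theorem evalEval_corrPoly {k n : ℕ} (Q : ℕ → ℂ[X]) (hn : k ≤ n) (z w : ℂ) :
    (corrPoly k Q n).evalEval z w = 0 ↔ (weighted k Q (weight k n) z).IsRoot w := by
  have hne : (n.descFactorial k : ℂ) ≠ 0 := by exact_mod_cast (Nat.descFactorial_pos.2 hn).ne'
  rw [← eval₂_evalRingHom, ← eval_map, map_corrPoly Q hn]
  simp [hne]

theorem natDegree_corrPoly_le {k n : ℕ} {Q : ℕ → ℂ[X]} (hT : NonDegenerate k Q) (hn : k ≤ n) :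
    (corrPoly k Q n).natDegree ≤ (Q k).natDegree := by
  rw [corrPoly_eq k Q n hn]
  refine natDegree_sum_le_of_forall_le _ _ fun j hj => ?_
  have hj' : j ≤ k := Nat.lt_succ_iff.1 (Finset.mem_range.1 hj)
  by_cases h0 : Q j = 0
  · simp [h0]
  refine (natDegree_smul_le _ _).trans (natDegree_mul_le.trans ?_)
  rw [(monic_X_sub_C _).natDegree_pow, natDegree_X_sub_C, mul_one]
  exact (add_le_add_left natDegree_map_le _).trans (hT.natDegree_add_le hj' h0)

/-- The extra zero w = z is harmless for invariance, so Hutchinson invariance amounts to invariance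
under T_n. -/
theorem eval_diffOp_eq_zero_iff {k n : ℕ} (Q : ℕ → ℂ[X]) (hn : k ≤ n) (z w : ℂ) :
    (diffOp k Q ((X - C z) ^ n)).eval w = 0 ↔
      (k < n ∧ w = z) ∨ (corrPoly k Q n).evalEval z w = 0 := by
  have h1 : (∑ j ∈ Finset.range (k + 1), (n.descFactorial j) • (Q j * (X - C z) ^ (k - j))) =
      (corrPoly k Q n).map (evalRingHom z) := by
    rw [map_corrPoly Q hn, weighted, Finset.mul_sum]
    have hne : (n.descFactorial k : ℂ) ≠ 0 := by exact_mod_cast (Nat.descFactorial_pos.2 hn).ne'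
    refine Finset.sum_congr rfl fun j _ => ?_
    rw [← mul_assoc, ← C_mul, weight, mul_div_cancel₀ _ hne]
    simp
  rw [diffOp_pow_eq_mul k Q z n hn, eval_mul, mul_eq_zero, h1, eval_map, eval₂_evalRingHom]
  refine or_congr ?_ Iff.rfl
  rw [eval_pow, eval_sub, eval_X, eval_C]
  rcases hn.eq_or_lt with rfl | hlt
  · simp
  · rw [pow_eq_zero_iff (by omega), sub_eq_zero]
    exact ⟨fun h => ⟨hlt, h⟩, And.right⟩

end HolCorr

namespace HolCorr

theorem IsContracting.exists_isContractive {k n : ℕ} {Q : ℕ → ℂ[X]} {R ρ β : ℝ} {q : NNReal}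
    (h : IsContracting k Q (weight k n) R ρ β q) (hR : 0 < R) (hβ : 0 < β) (hq : q < 1)
    (hT : NonDegenerate k Q) (hd : 1 ≤ (Q k).natDegree)
    (hsimple : ∀ u : ℂ, (Q k).IsRoot u → (Q k).rootMultiplicity u = 1) (hn : k ≤ n) :
    ∃ f : RootIndex k Q → ℂ → ℂ, IsContractive (corrPoly k Q n) f R q ∧
      ∀ (u : RootIndex k Q) (z : ℂ), ‖z‖ ≤ R → f u z ∈ Metric.ball (u : ℂ) ρ := by
  have hex : ∀ z : ℂ, ∃ g : RootIndex k Q → ℂ, ‖z‖ ≤ R →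
      (∀ u : RootIndex k Q, g u ∈ Metric.ball (u : ℂ) ρ) ∧
      (weighted k Q (weight k n) z).roots = Finset.univ.val.map g := by
    intro z
    by_cases hz : ‖z‖ ≤ R
    · obtain ⟨g, hg⟩ := h.exists_branches hβ hT.1 hd hsimple hz
      exact ⟨g, fun _ => hg⟩
    -- Outside the disc the branches get a dummy value.
    · exact ⟨fun _ => 0, fun h => absurd h hz⟩
  choose g hg using hex
  have hne : (n.descFactorial k : ℂ) ≠ 0 := by exact_mod_cast (Nat.descFactorial_pos.2 hn).ne'
  have hdeg : ∀ a, ((corrPoly k Q n).map (evalRingHom a)).natDegree = (Q k).natDegree := fun a => by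
    rw [map_corrPoly Q hn, natDegree_C_mul hne, h.natDegree_eq]
  have hroot : ∀ (u : RootIndex k Q) (z : ℂ), ‖z‖ ≤ R →
      (weighted k Q (weight k n) z).IsRoot (g z u) := by
    intro u z hz
    refine isRoot_of_mem_roots ?_
    rw [(hg z hz).2]
    exact Multiset.mem_map_of_mem _ (Finset.mem_univ_val _)
  refine ⟨fun u z => g z u, ⟨hR, ?_, fun a => ?_, fun z w hw => ?_, fun z hz => ?_, fun u => ?_,
    fun u z hz => ?_, hq⟩, fun u z hz => (hg z hz).1 u⟩
  · rw [card_rootIndex hsimple]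
    refine le_antisymm (natDegree_corrPoly_le hT hn) ?_
    rw [← hdeg 0]
    exact natDegree_map_le
  · rw [card_rootIndex hsimple, hdeg]
  · exact h.norm_lt z w ((evalEval_corrPoly Q hn z w).1 hw)
  · rw [map_corrPoly Q hn, roots_C_mul _ hne, (hg z hz).2]
  · refine LipschitzOnWith.of_dist_le_mul fun z hz z' hz' => ?_
    rw [mem_closedBall_zero_iff] at hz hz'
    rw [dist_eq_norm, dist_eq_norm]
    exact h.norm_sub_le hβ hz hz' u.isRoot ((hg z hz).1 u) ((hg z' hz').1 u) (hroot u z hz)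
      (hroot u z' hz')
  · exact (h.differentiableAt hβ u.isRoot (fun z hz => ⟨(hg z hz).1 u, hroot u z hz⟩)
      (mem_ball_zero_iff.1 hz)).differentiableWithinAt

end HolCorr

end

/-! ### Choice of constants and conclusion. -/

theorem theoremC (k : ℕ) (hk : 1 ≤ k) (Q : ℕ → ℂ[X])
    (hT : HolCorr.NonDegenerate k Q)
    (hd : 1 ≤ (Q k).natDegree)
    (hsimple : ∀ u : ℂ, (Q k).IsRoot u → (Q k).rootMultiplicity u = 1)
    (ε : ℝ) (hε : 0 < ε) :
    ∃ N : ℕ, k ≤ N ∧ ∀ n : ℕ, N ≤ n →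
      ∃ (μ : Measure (OnePoint ℂ)) (S : Set ℂ),
        -- the degree of `T_n` is `deg Q_k`
        (HolCorr.corrPoly k Q n).natDegree = (Q k).natDegree ∧
        -- the invariant probability measure `μ` of `T_n`
        IsProbabilityMeasure μ ∧
        HolCorr.IsPushforward (HolCorr.corrPoly k Q n) μ
          (((Q k).natDegree : ENNReal) • μ) ∧
        -- equidistribution of the images of every `a ∈ ℂ` (weak * convergence)
        (∀ (a : ℂ) (φ : C(OnePoint ℂ, ℝ)),
          Tendsto (fun m : ℕ => (1 / ((Q k).natDegree : ℝ) ^ m) *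
              ∫ x, φ x ∂(HolCorr.pushDirac (HolCorr.corrPoly k Q n) m (a : OnePoint ℂ)))
            atTop (𝓝 (∫ x, φ x ∂μ))) ∧
        μ.support ⊆ (fun u : ℂ => (u : OnePoint ℂ)) ''
          Metric.thickening ε {u : ℂ | (Q k).IsRoot u} ∧
        -- the support is the minimal closed forward invariant set containing a point of `ℂ`
        IsLeast {K : Set (OnePoint ℂ) | IsClosed K ∧
          HolCorr.ForwardInvariant (HolCorr.corrPoly k Q n) K ∧
          ∃ a : ℂ, (a : OnePoint ℂ) ∈ K} μ.support ∧
        -- the minimal Hutchinson invariant set `S` exists and equals the support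
        IsLeast {S' : Set ℂ | HolCorr.HutchinsonInvariant k Q n S'} S ∧
        (fun u : ℂ => (u : OnePoint ℂ)) '' S = μ.support ∧
        -- its points are limits of attracting periodic points and are close to the zeros of `Q_k`
        (∀ w ∈ S, ∃ v : ℕ → ℂ,
          (∀ i, HolCorr.IsAttractingPeriodic (HolCorr.corrPoly k Q n) (v i)) ∧
          Tendsto v atTop (𝓝 w)) ∧
        S ⊆ Metric.thickening ε {u : ℂ | (Q k).IsRoot u} ∧
        -- the Cantor property
        (2 ≤ k → (∃ j < k, Q j ≠ 0) →
          2 ≤ (Q k).natDegree → (¬ ∃ c : ℂ, ∀ j ≤ k, (Q j).eval c = 0) →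
          HolCorr.IsCantorSet S) := by
  set d := (Q k).natDegree with hd_def
  -- This gives q < 1 for the contraction and dq < 1 for total disconnectedness.
  let q : NNReal := 1 / (2 * (d + 1))
  have hq0 : 0 < q := by positivity
  have hq1 : q < 1 := by
    rw [div_lt_one (by positivity)]
    exact_mod_cast (by omega : 1 < 2 * (d + 1))
  have hdq : (d : NNReal) * q < 1 := by
    rw [mul_one_div, div_lt_one (by positivity)]
    exact_mod_cast (by omega : d < 2 * (d + 1))
  obtain ⟨r, hr0, hr⟩ := HolCorr.exists_forall_le_norm_eval (Q (k - d + 1)) (Q k).roots.toFinset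
  obtain ⟨ρ, hρ0, hρ, R, hR, β, hβ, η₀, hη₀, hcontr⟩ :=
    HolCorr.exists_isContracting hT hsimple (ε := min ε r) (q := q) (lt_min hε hr0) hq0
  have hρε : ρ ≤ ε := hρ.trans (min_le_left _ _)
  have hρr : ρ ≤ r := hρ.trans (min_le_right _ _)
  -- Here m stands for n - k. The first bound makes the branches contract, the second enters the
  -- proof that the attractor is infinite.
  obtain ⟨M, hM⟩ : ∃ M : ℕ, ∀ m ≥ M, 1 / ((m : ℝ) + 1) ≤ η₀ ∧
      1 / ((m : ℝ) + 1) * (‖(Q (k - d)).coeff 0‖ * (d * (2 * R))) < r := by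
    have h1 := tendsto_one_div_add_atTop_nhds_zero_nat (𝕜 := ℝ)
    have h2 := h1.mul_const (‖(Q (k - d)).coeff 0‖ * (d * (2 * R)))
    rw [zero_mul] at h2
    exact eventually_atTop.1 ((h1.eventually (ge_mem_nhds hη₀)).and
      (h2.eventually (gt_mem_nhds hr0)))
  refine ⟨k + M, Nat.le_add_right _ _, fun n hn => ?_⟩
  have hkn : k ≤ n := by omega
  obtain ⟨hη, hηr⟩ := hM (n - k) (by omega)
  have hη0 : 0 ≤ 1 / (((n - k : ℕ) : ℝ) + 1) := by positivity
  have hw := HolCorr.smallWeights_weight hkn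
  have hC := hcontr _ _ hη0 hη hw
  obtain ⟨f, hf, hfρ⟩ := hC.exists_isContractive hR hβ hq1 hT hd hsimple hkn
  have hcard : Fintype.card (HolCorr.RootIndex k Q) = d := HolCorr.card_rootIndex hsimple
  have hne : Nonempty (HolCorr.RootIndex k Q) := Fintype.card_pos_iff.1 (by omega)
  obtain ⟨μ, S, hμ, hpush, hequi, hScomp, hSR, hSne, hmaps, hsurj, hsupp, hmin⟩ := hf.exists_measure
  rw [hcard] at hpush hequi
  have hSn : ∀ z ∈ S, ‖z‖ ≤ R := fun z hz => mem_closedBall_zero_iff.1 (hSR hz)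
  have hinv : ∀ z ∈ S, ∀ w, (HolCorr.corrPoly k Q n).evalEval z w = 0 → w ∈ S := by
    intro z hz w hw
    obtain ⟨u, rfl⟩ := (hf.evalEval_eq_zero_iff (hSn z hz) w).1 hw
    exact hmaps u hz
  have hmin' : ∀ S' : Set ℂ, IsClosed S' → S'.Nonempty →
      (∀ z ∈ S', ∀ w, (HolCorr.corrPoly k Q n).evalEval z w = 0 → w ∈ S') → S ⊆ S' :=
    fun S' h1 h2 h3 => hmin S' h1 (hf.exists_mem_norm_le h3 h2) fun z hz hzR u =>
      h3 z hz _ ((hf.evalEval_eq_zero_iff hzR _).2 ⟨u, rfl⟩)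
  have hthick : S ⊆ Metric.thickening ε {u : ℂ | (Q k).IsRoot u} := by
    intro x hx
    obtain ⟨u, y, hy, rfl⟩ := hsurj x hx
    exact Metric.mem_thickening_iff.2 ⟨u, u.isRoot, Metric.ball_subset_ball hρε
      (hfρ u y (hSn y hy))⟩
  refine ⟨μ, S, hf.natDegree_eq.trans hcard, hμ, hpush, hequi, ?_, ⟨⟨?_, ?_, ?_⟩, ?_⟩,
    ⟨⟨?_, ?_, ?_⟩, ?_⟩,
    hsupp, fun w hw => hf.exists_seq_isAttractingPeriodic hSR hsurj hw, hthick, ?_⟩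
  · rw [← hsupp]
    exact Set.image_mono hthick
  · exact Measure.isClosed_support
  · rw [← hsupp]
    rintro _ ⟨z, hz, rfl⟩
    rw [hf.image_coe]
    exact Set.image_mono fun w hw => hinv z hz w hw
  · obtain ⟨a, ha⟩ := hSne
    exact ⟨a, hsupp ▸ ⟨a, ha, rfl⟩⟩
  · rintro K ⟨hK, hKinv, a, ha⟩
    rw [← hsupp]
    rintro _ ⟨z, hz, rfl⟩
    refine hmin' ((fun u : ℂ => (u : OnePoint ℂ)) ⁻¹' K) (hK.preimage OnePoint.continuous_coe)
      ⟨a, ha⟩ (fun z hz w hw => hKinv _ hz ?_) hz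
    rw [hf.image_coe]
    exact ⟨w, hw, rfl⟩
  · exact hScomp.isClosed
  · exact hSne
  · intro z hz w hw
    rcases (HolCorr.eval_diffOp_eq_zero_iff Q hkn z w).1 hw with ⟨-, rfl⟩ | h
    · exact hz
    · exact hinv z hz w h
  · rintro S' ⟨h1, h2, h3⟩
    exact hmin' S' h1 h2 fun z hz w hw =>
      h3 z hz w ((HolCorr.eval_diffOp_eq_zero_iff Q hkn z w).2 (Or.inr hw))
  · intro _ _ hd2 hQ
    refine IFS.nonempty_homeomorph_cantorSet hq1 (by rw [hcard]; exact hdq)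
      (fun u => (hf.lipschitz u).mono hSR) hmaps hsurj (fun u y hy => ?_) hScomp ?_
    · refine (HolCorr.finite_cofibre hw.ne_zero hQ y).subset fun z hz => ?_
      rw [Set.mem_ofPred_eq, ← HolCorr.evalEval_corrPoly Q hkn,
        hf.evalEval_eq_zero_iff (hSn z hz.1)]
      exact ⟨u, hz.2⟩
    · exact hC.infinite_of_invariant hβ hT hsimple hd2 hQ hw hη0 hρr hr hηr hSR hSne
        fun z hz w hw => hinv z hz w ((HolCorr.evalEval_corrPoly Q hkn z w).2 hw)
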